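/- For $n\ge 3$ let $G=\mathbb Z/2^n\mathbb Z$ be the cyclic group of order $2^n$, and let $\mathrm{Hol}(G)\le\mathrm{Sym}(G)$ be its holomorph, i.e. the subgroup of $\mathrm{Sym}(G)$ generated by the translations $x\mapsto x+g$ ($g\in G$) and by $\mathrm{Aut}(G)$. For odd $k$ let $\sigma_k\in\mathrm{Aut}(G)$ be $x\mapsto kx$. The $2$-groups $\mathsf{SD}_{2^n}$ and $\mathsf{M}_{2^n}$ are given by the presentations $$\mathsf{SD}_{2^n}=\langle x,y : x^{2^{n-1}}=y^2=1,\ y^{-1}xy=x^{2^{n-2}-1}\rangle,\qquad \mathsf{M}_{2^n}=\langle x,y : x^{2^{n-1}}=y^2=1,\ y^{-1}xy=x^{2^{n-2}+1}\rangle$$ (for $n=3$ these are isomorphic to $\mathsf{C}_2\times\mathsf{C}_4$ and to $\mathsf{D}_8$, respectively), and $\mathsf{C}_{2^n}$, $\mathsf{Q}_{2^n}$, $\mathsf{D}_{2^n}$ denote the cyclic, the (generalized) quaternion and the dihedral group of order $2^n$. For every $n\ge 3$: 1. There are exactly four regular subgroups of $\mathrm{Hol}(G)$ that are normal in $\mathrm{Hol}(G)$,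 namely $N_1,N_2,N_3,N_4$, where $N_i=\{\,x\mapsto \gamma_i(g)(x)+g : g\in G\,\}$ with $\gamma_1(g)=\sigma_1$, $\gamma_2(g)=\sigma_{2^{n-1}+1}^{\,g}$, $\gamma_3(g)=\sigma_{2^{n-1}-1}^{\,g}$, $\gamma_4(g)=\sigma_{2^n-1}^{\,g}$. 2. The number of regular subgroups of $\mathrm{Hol}(G)$ isomorphic to $\mathsf{C}_{2^n}$ is exactly $2^{n-2}$; to $\mathsf{Q}_{2^n}$, exactly $1$; to $\mathsf{D}_{2^n}$, exactly $1$; to $\mathsf{SD}_{2^n}$, exactly $2$; to $\mathsf{C}_2\times\mathsf{C}_{2^{n-1}}$, exactly $2^{n-2}$; and, if $n\ge 4$, to $\mathsf{M}_{2^n}$, exactly $2^{n-2}$. 3. Every regular subgroup of $\mathrm{Hol}(G)$ is isomorphic to one of $\mathsf{C}_{2^n}$, $\mathsf{Q}_{2^n}$, $\mathsf{D}_{2^n}$, $\mathsf{SD}_{2^n}$, $\mathsf{C}_2\times\mathsf{C}_{2^{n-1}}$, $\mathsf{M}_{2^n}$; and, if $n\ge 4$, $\mathrm{Hol}(G)$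 has exactly $3\cdot 2^{n-2}+4$ regular subgroups. -/

import Mathlib

/-- The (permutational) holomorph of an additively written group `G`: the subgroup of `Sym(G)`
generated by the right translations `x ↦ x + g` and by the automorphisms of `G`. -/
def Holomorph (G : Type*) [AddGroup G] : Subgroup (Equiv.Perm G) :=
  Subgroup.closure
    (Set.range (fun g : G => Equiv.addRight g) ∪
      Set.range (fun α : AddAut G => (AddEquiv.toEquiv α : Equiv.Perm G)))

/-- A permutation group on `X` is regular if for all `x, y` exactly one of its elements
maps `x` to `y`. -/
def IsRegularPermGroup {X : Type*} (N : Subgroup (Equiv.Perm X)) : Prop :=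
  ∀ x y : X, ∃! p : Equiv.Perm X, p ∈ N ∧ p x = y

/-- The set of regular subgroups of the holomorph of `G`. -/
def regularSubgroups (G : Type*) [AddGroup G] : Set (Subgroup (Equiv.Perm G)) :=
  {N | N ≤ Holomorph G ∧ IsRegularPermGroup N}

/-- The set of regular subgroups of the holomorph of `G` that are normal in the holomorph. -/
def regularNormalSubgroups (G : Type*) [AddGroup G] : Set (Subgroup (Equiv.Perm G)) :=
  {N | N ∈ regularSubgroups G ∧ (N.subgroupOf (Holomorph G)).Normal}

/-- The set of regular subgroups of the holomorph of `G` that are isomorphic to `H`. -/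
def regularSubgroupsOfType (G : Type*) [AddGroup G] (H : Type*) [Group H] :
    Set (Subgroup (Equiv.Perm G)) :=
  {N | N ∈ regularSubgroups G ∧ Nonempty (N ≃* H)}

/-- The relators of `⟨x, y : x ^ (2 ^ (n - 1)) = y ^ 2 = 1, y⁻¹ x y = x ^ e⟩`,
with `x` the generator `0` and `y` the generator `1`. -/
def metacyclicRelators (n e : ℕ) : Set (FreeGroup (Fin 2)) :=
  {FreeGroup.of 0 ^ 2 ^ (n - 1),
    FreeGroup.of 1 ^ 2,
    (FreeGroup.of 1)⁻¹ * FreeGroup.of 0 * FreeGroup.of 1 * (FreeGroup.of 0 ^ e)⁻¹}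

/-- The semidihedral group of order `2 ^ n`. -/
abbrev SemidihedralTwoGroup (n : ℕ) : Type :=
  PresentedGroup (metacyclicRelators n (2 ^ (n - 2) - 1))

/-- The modular group of order `2 ^ n`. -/
abbrev ModularTwoGroup (n : ℕ) : Type :=
  PresentedGroup (metacyclicRelators n (2 ^ (n - 2) + 1))

/-- The automorphism `σ_k : x ↦ k x` of `ℤ / 2 ^ n`, for `k` odd. -/
def sigmaAut (n k : ℕ) (hk : Odd k) : AddAut (ZMod (2 ^ n)) :=
  (AddAut.mulLeft (ZMod.unitOfCoprime k (hk.coprime_two_right.pow_right n))).toAdd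

/-- For a function `γ : ℤ / 2 ^ n → Aut(ℤ / 2 ^ n)`, the set of the permutations
`ν(g) : x ↦ γ(g)(x) + g`. -/
def gammaPerms (n : ℕ) (γ : ZMod (2 ^ n) → AddAut (ZMod (2 ^ n))) :
    Set (Equiv.Perm (ZMod (2 ^ n))) :=
  Set.range (fun g => (AddEquiv.toEquiv (γ g)).trans (Equiv.addRight g))

/-- The function `γ(x) = α ^ x` (meant for `α ^ 2 = 1`, when the exponent matters only modulo `2`,
so that any integer representative of `x` may be taken). The group structure on `AddAut` is
composition, written additively, so `k • α` is the `k`-fold composite of `α` with itself. -/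
def powGamma (n : ℕ) (α : AddAut (ZMod (2 ^ n))) : ZMod (2 ^ n) → AddAut (ZMod (2 ^ n)) :=
  fun x => x.val • α

theorem odd_half_add_one {n : ℕ} (hn : 3 ≤ n) : Odd (2 ^ (n - 1) + 1) :=
  (even_two.pow_of_ne_zero (by omega)).add_one

theorem odd_half_sub_one {n : ℕ} (hn : 3 ≤ n) : Odd (2 ^ (n - 1) - 1) :=
  Nat.Even.sub_odd Nat.one_le_two_pow (even_two.pow_of_ne_zero (by omega)) odd_one

theorem odd_full_sub_one {n : ℕ} (hn : 3 ≤ n) : Odd (2 ^ n - 1) :=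
  Nat.Even.sub_odd Nat.one_le_two_pow (even_two.pow_of_ne_zero (by omega)) odd_one

/-!
Put `R = ℤ / 2 ^ n`. The holomorph of `R` consists of the permutations `x ↦ a * x + b`, so a regular
subgroup contains exactly one permutation `ν(g) : x ↦ γ g * x + g` for each `g : R`. This
identifies the regular subgroups with the functions `γ : R → Rˣ` such that
`γ (g + γ g * h) = γ g * γ h` (`IsGamma`, `exists_gammaSubgroup_eq`).

All such functions can be written down. If `γ g = 1 + c * g` for one `g`, with `c` even and
`4 ∣ c * g`, the same formula holds at all multiples of `g` (`IsGamma.apply_mul_of_apply`); the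
reason is that under the powers of `ν(g)` the orbit of `0` is `g * R`. If `γ` is `1` modulo `4` at
an odd element, the formula thus holds everywhere. Otherwise `γ` is `3` modulo `4` at all odd
elements, hence `1` modulo `4` at `2`, so that the formula holds at the even elements,
and at the odd ones it holds up to a constant `t` (`IsGamma.exists_eq_pairGamma`). Such a function
`pairGamma c t` satisfies the functional equation if and only if `2 * c * t = 0` and
`t * (2 + c + t) = 0`. Solving these equations, up to adding `2 ^ (n - 1)` to both `c` and `t`,
gives six explicit families (`mem_family_of_mem_regularSubgroups`).

Outside the cyclic family, `ν(2)` generates a subgroup of index `2`, and the type of the group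
follows from its relations with a suitable `ν(g)`, `g` odd: a group with such a pair of generators
is determined by the relations and its order (`IsMetacyclicPair`). That the six types differ is seen
from whether the group is commutative or cyclic, whether its squares or its involutions are central,
and whether elements with nontrivial squares commute. For `n = 3` two of the families are absent,
and the semidihedral presentation defines `C₂ × C₄`.

Normality in the holomorph is treated without the classification. If the group of `γ` is normalized
by the automorphisms then `γ` is constant on odd elements, hence `1` on even ones by the functional
equation, and its value `u` at `1` satisfies `u ^ 2 = 1`; there are four such `u`.
-/

/-! ### Arithmetic in the integers modulo a power of two -/

namespace ZModTwoPow

variable {n : ℕ}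

theorem two_pow_self : (2 : ZMod (2 ^ n)) ^ n = 0 := by
  have h := ZMod.natCast_self (2 ^ n)
  push_cast at h
  exact h

theorem two_mul_half (hn : 1 ≤ n) : (2 : ZMod (2 ^ n)) * 2 ^ (n - 1) = 0 := by
  rw [← pow_succ', Nat.sub_add_cancel hn, two_pow_self]

theorem four_mul_quarter (hn : 2 ≤ n) : (4 : ZMod (2 ^ n)) * 2 ^ (n - 2) = 0 := by
  rw [show (4 : ZMod (2 ^ n)) = 2 ^ 2 by norm_num, ← pow_add, Nat.add_sub_cancel' hn, two_pow_self]

theorem two_mul_quarter (hn : 2 ≤ n) : (2 : ZMod (2 ^ n)) * 2 ^ (n - 2) = 2 ^ (n - 1) := by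
  rw [← pow_succ', show n - 2 + 1 = n - 1 by omega]

theorem even_or_odd (x : ZMod (2 ^ n)) : Even x ∨ Odd x := by
  rw [← ZMod.natCast_zmod_val x]
  exact (Nat.even_or_odd x.val).imp (fun h => h.natCast) (fun h => h.natCast)

theorem isUnit_of_odd {x : ZMod (2 ^ n)} (hx : Odd x) : IsUnit x := by
  obtain ⟨k, rfl⟩ := hx
  have h2 : IsNilpotent (2 : ZMod (2 ^ n)) := ⟨n, two_pow_self⟩
  exact ((Commute.all _ _).isNilpotent_mul_right h2).isUnit_add_one

theorem nontrivial (hn : 1 ≤ n) : Nontrivial (ZMod (2 ^ n)) :=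
  have : Fact (1 < 2 ^ n) := ⟨Nat.one_lt_two_pow (by omega)⟩
  inferInstance

theorem not_isUnit_of_even (hn : 1 ≤ n) {x : ZMod (2 ^ n)} (hx : Even x) : ¬ IsUnit x := by
  have := nontrivial hn
  have h2 : IsNilpotent (2 : ZMod (2 ^ n)) := ⟨n, two_pow_self⟩
  obtain ⟨k, rfl⟩ := hx.two_dvd
  exact ((Commute.all _ _).isNilpotent_mul_right h2).not_isUnit

theorem not_odd_of_even (hn : 1 ≤ n) {x : ZMod (2 ^ n)} (hx : Even x) : ¬ Odd x :=
  fun h => not_isUnit_of_even hn hx (isUnit_of_odd h)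

theorem not_even_of_odd (hn : 1 ≤ n) {x : ZMod (2 ^ n)} (hx : Odd x) : ¬ Even x :=
  fun h => not_odd_of_even hn h hx

theorem odd_of_isUnit (hn : 1 ≤ n) {x : ZMod (2 ^ n)} (hx : IsUnit x) : Odd x :=
  (even_or_odd x).resolve_left fun h => not_isUnit_of_even hn h hx

/-- Every odd divisor of `y` has a quotient, since odd elements are invertible. -/
theorem exists_mul_eq_of_odd {x : ZMod (2 ^ n)} (hx : Odd x) (y : ZMod (2 ^ n)) :
    ∃ z, x * z = y := by
  obtain ⟨u, rfl⟩ := isUnit_of_odd hx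
  exact ⟨(u⁻¹ : (ZMod (2 ^ n))ˣ) * y, by simp⟩

theorem odd_mul_eq_zero {x y : ZMod (2 ^ n)} (hx : Odd x) (h : x * y = 0) : y = 0 :=
  (isUnit_of_odd hx).mul_right_eq_zero.mp h

theorem two_pow_mul_eq_zero {k : ℕ} (hk : k ≤ n) {x : ZMod (2 ^ n)} (h : 2 ^ k * x = 0) :
    ∃ y, x = 2 ^ (n - k) * y := by
  rw [← ZMod.natCast_zmod_val x] at h ⊢
  have h' : ((2 ^ k * x.val : ℕ) : ZMod (2 ^ n)) = 0 := by push_cast; exact_mod_cast h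
  have hp : 2 ^ n = 2 ^ k * 2 ^ (n - k) := by rw [← pow_add, Nat.add_sub_cancel' hk]
  generalize x.val = v at h' ⊢
  rw [ZMod.natCast_eq_zero_iff, hp, Nat.mul_dvd_mul_iff_left (by positivity)] at h'
  obtain ⟨y, hy⟩ := h'
  exact ⟨y, by rw [hy]; push_cast; rfl⟩

theorem two_mul_eq_zero (hn : 1 ≤ n) {x : ZMod (2 ^ n)} (h : 2 * x = 0) :
    x = 0 ∨ x = 2 ^ (n - 1) := by
  obtain ⟨y, rfl⟩ := two_pow_mul_eq_zero (k := 1) hn (by simpa using h)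
  obtain h' | ⟨z, rfl⟩ := even_or_odd y
  · obtain ⟨z, rfl⟩ := h'.two_dvd
    left; linear_combination z * two_mul_half hn
  · right; linear_combination z * two_mul_half hn

theorem four_mul_eq_zero (hn : 2 ≤ n) {x : ZMod (2 ^ n)} (h : 4 * x = 0) :
    x = 0 ∨ x = 2 ^ (n - 1) ∨ x = 2 ^ (n - 2) ∨ x = 2 ^ (n - 2) + 2 ^ (n - 1) := by
  obtain ⟨y, rfl⟩ := two_pow_mul_eq_zero (k := 2) hn (by linear_combination h)
  have h4 := four_mul_quarter hn
  have h2 := two_mul_quarter hn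
  obtain h' | ⟨z, rfl⟩ := even_or_odd y
  · obtain ⟨z, rfl⟩ := h'.two_dvd
    obtain h' | ⟨w, rfl⟩ := even_or_odd z
    · obtain ⟨w, rfl⟩ := h'.two_dvd
      left; linear_combination w * h4
    · right; left; linear_combination w * h4 + h2
  · obtain h' | ⟨w, rfl⟩ := even_or_odd z
    · obtain ⟨w, rfl⟩ := h'.two_dvd
      right; right; left; linear_combination w * h4
    · right; right; right; linear_combination w * h4 + h2

theorem two_pow_ne_zero {k : ℕ} (hk : k < n) : (2 : ZMod (2 ^ n)) ^ k ≠ 0 := by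
  intro h
  have h' : ((2 ^ k : ℕ) : ZMod (2 ^ n)) = 0 := by push_cast; exact h
  rw [ZMod.natCast_eq_zero_iff, Nat.pow_dvd_pow_iff_le_right (by norm_num)] at h'
  omega

theorem four_ne_zero (hn : 3 ≤ n) : (4 : ZMod (2 ^ n)) ≠ 0 := by
  have := two_pow_ne_zero (n := n) (k := 2) (by omega)
  norm_num at this
  exact this

theorem eight_ne_zero (hn : 4 ≤ n) : (8 : ZMod (2 ^ n)) ≠ 0 := by
  have := two_pow_ne_zero (n := n) (k := 3) (by omega)
  norm_num at this
  exact this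

theorem half_ne_zero (hn : 1 ≤ n) : (2 : ZMod (2 ^ n)) ^ (n - 1) ≠ 0 :=
  two_pow_ne_zero (by omega)

theorem two_pow_mul_odd_ne_zero {k : ℕ} (hk : k < n) {x : ZMod (2 ^ n)} (hx : Odd x) :
    2 ^ k * x ≠ 0 := fun h => two_pow_ne_zero hk (odd_mul_eq_zero hx (by rw [mul_comm, h]))

theorem half_mul_odd (hn : 1 ≤ n) {x : ZMod (2 ^ n)} (hx : Odd x) :
    2 ^ (n - 1) * x = 2 ^ (n - 1) := by
  obtain ⟨k, rfl⟩ := hx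
  linear_combination k * two_mul_half hn

theorem half_mul_even (hn : 1 ≤ n) {x : ZMod (2 ^ n)} (hx : Even x) :
    2 ^ (n - 1) * x = 0 := by
  obtain ⟨k, rfl⟩ := hx.two_dvd
  linear_combination k * two_mul_half hn

theorem four_dvd_or (x : ZMod (2 ^ n)) (hx : Even x) : 4 ∣ x ∨ 4 ∣ x - 2 := by
  obtain ⟨k, rfl⟩ := hx.two_dvd
  obtain h | ⟨l, rfl⟩ := even_or_odd k
  · obtain ⟨l, rfl⟩ := h.two_dvd
    exact Or.inl ⟨l, by ring⟩
  · exact Or.inr ⟨l, by ring⟩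

theorem four_dvd_quarter (hn : 4 ≤ n) : (4 : ZMod (2 ^ n)) ∣ 2 ^ (n - 2) := by
  obtain ⟨m, rfl⟩ := Nat.exists_eq_add_of_le hn
  exact ⟨2 ^ m, by rw [show 4 + m - 2 = m + 2 by omega]; ring⟩

theorem four_dvd_half (hn : 3 ≤ n) : (4 : ZMod (2 ^ n)) ∣ 2 ^ (n - 1) := by
  obtain ⟨m, rfl⟩ := Nat.exists_eq_add_of_le hn
  exact ⟨2 ^ m, by rw [show 3 + m - 1 = m + 2 by omega]; ring⟩

theorem even_of_four_dvd {x : ZMod (2 ^ n)} (h : 4 ∣ x) : Even x :=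
  even_iff_two_dvd.mpr ((Dvd.intro 2 (by norm_num)).trans h)

theorem even_of_four_dvd_sub_two {x : ZMod (2 ^ n)} (h : 4 ∣ x - 2) : Even x := by
  have := (even_of_four_dvd h).add even_two
  rwa [sub_add_cancel] at this

/-- If `x ≡ 2` modulo `4` then `x` is twice an odd element. -/
theorem exists_odd_of_four_dvd_sub_two {x : ZMod (2 ^ n)} (h : 4 ∣ x - 2) :
    ∃ y, Odd y ∧ x = 2 * y := by
  obtain ⟨k, hk⟩ := h
  exact ⟨2 * k + 1, ⟨k, rfl⟩, by linear_combination hk⟩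

/-- The square roots of `1` modulo `2 ^ n`. -/
theorem mul_self_eq_one (hn : 3 ≤ n) {u : ZMod (2 ^ n)} (h : u * u = 1) :
    u = 1 ∨ u = 2 ^ (n - 1) + 1 ∨ u = 2 ^ (n - 1) - 1 ∨ u = -1 := by
  have hu : Odd u := odd_of_isUnit (by omega) (IsUnit.of_mul_eq_one _ h)
  obtain ⟨a, rfl⟩ := hu
  obtain ha | ha := even_or_odd a
  · have h0 : (2 : ZMod (2 ^ n)) * (2 * a) = 0 :=
      odd_mul_eq_zero ha.add_one (by linear_combination h)
    obtain h1 | h1 := two_mul_eq_zero (by omega) h0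
    · left; linear_combination h1
    · right; left; linear_combination h1
  · have h0 : (2 : ZMod (2 ^ n)) * (2 * (a + 1)) = 0 :=
      odd_mul_eq_zero ha (by linear_combination h)
    obtain h1 | h1 := two_mul_eq_zero (by omega) h0
    · right; right; right; linear_combination h1
    · right; right; left; linear_combination h1

theorem ncard_four_dvd (hn : 2 ≤ n) : {c : ZMod (2 ^ n) | 4 ∣ c}.ncard = 2 ^ (n - 2) := by
  have h4 : 2 ^ n = 4 * 2 ^ (n - 2) := by
    rw [show 4 = 2 ^ 2 by norm_num, ← pow_add, Nat.add_sub_cancel' hn]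
  have : {c : ZMod (2 ^ n) | 4 ∣ c} =
      (fun k : ℕ => ((4 * k : ℕ) : ZMod (2 ^ n))) '' (Finset.range (2 ^ (n - 2)) : Set ℕ) := by
    ext c
    simp only [Set.mem_ofPred_eq, Set.mem_image, Finset.coe_range, Set.mem_Iio]
    constructor
    · rintro ⟨d, rfl⟩
      refine ⟨d.val % 2 ^ (n - 2), Nat.mod_lt _ (by positivity), ?_⟩
      conv_rhs => rw [← ZMod.natCast_zmod_val d, ← Nat.mod_add_div d.val (2 ^ (n - 2))]
      push_cast
      linear_combination -(d.val / 2 ^ (n - 2) : ℕ) * four_mul_quarter hn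
    · rintro ⟨k, -, rfl⟩
      exact ⟨k, by push_cast; rfl⟩
  rw [this, Set.InjOn.ncard_image, Set.ncard_coe_finset, Finset.card_range]
  intro k hk l hl hkl
  simp only [Finset.coe_range, Set.mem_Iio] at hk hl
  rw [ZMod.natCast_eq_natCast_iff', Nat.mod_eq_of_lt (by omega), Nat.mod_eq_of_lt (by omega)] at hkl
  omega

theorem ncard_four_dvd_sub_two (hn : 2 ≤ n) :
    {c : ZMod (2 ^ n) | 4 ∣ c - 2}.ncard = 2 ^ (n - 2) := by
  rw [← ncard_four_dvd hn,
    ← Set.ncard_image_of_injective {c : ZMod (2 ^ n) | 4 ∣ c} (add_left_injective 2)]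
  congr 1
  ext c
  simp [sub_eq_add_neg]

end ZModTwoPow

/-! ### Regular subgroups of the holomorph and gamma functions -/

theorem isUnit_of_perm_apply {R : Type*} [CommRing R] {p : Equiv.Perm R} {a b : R}
    (hp : ∀ x, p x = a * x + b) : IsUnit a := by
  refine IsUnit.of_mul_eq_one (p.symm 1 - p.symm 0) ?_
  have h1 := hp (p.symm 1)
  have h0 := hp (p.symm 0)
  rw [Equiv.apply_symm_apply] at h0 h1
  linear_combination h0 - h1

theorem mem_holomorph_iff {n : ℕ} {p : Equiv.Perm (ZMod (2 ^ n))} :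
    p ∈ Holomorph (ZMod (2 ^ n)) ↔ ∃ a b, ∀ x, p x = a * x + b := by
  constructor
  · intro hp
    induction hp using Subgroup.closure_induction with
    | mem p hp =>
      obtain ⟨g, rfl⟩ | ⟨α, rfl⟩ := hp
      · exact ⟨1, g, fun x => by simp⟩
      · refine ⟨α 1, 0, fun x => ?_⟩
        have h := map_nsmul α x.val 1
        simp only [nsmul_eq_mul, mul_one, ZMod.natCast_zmod_val] at h
        simpa [mul_comm] using h
    | one => exact ⟨1, 0, fun x => by simp⟩
    | mul p q _ _ hp hq =>
      obtain ⟨a, b, hp⟩ := hp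
      obtain ⟨a', b', hq⟩ := hq
      exact ⟨a * a', a * b' + b, fun x => by rw [Equiv.Perm.mul_apply, hq, hp]; ring⟩
    | inv p _ hp =>
      obtain ⟨a, b, hp⟩ := hp
      have ha : a * (p⁻¹ 1 - p⁻¹ 0) = 1 := by
        have h1 := hp (p⁻¹ 1)
        have h0 := hp (p⁻¹ 0)
        rw [← Equiv.Perm.mul_apply, mul_inv_cancel, Equiv.Perm.one_apply] at h0 h1
        linear_combination h0 - h1
      refine ⟨p⁻¹ 1 - p⁻¹ 0, -((p⁻¹ 1 - p⁻¹ 0) * b), fun x => ?_⟩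
      rw [Equiv.Perm.inv_eq_iff_eq, hp]
      linear_combination (b - x) * ha
  · rintro ⟨a, b, hp⟩
    obtain ⟨u, rfl⟩ := isUnit_of_perm_apply hp
    have : p = Equiv.addRight b * (AddEquiv.toEquiv (AddAut.mulLeft u).toAdd) := by
      ext x
      exact hp x
    rw [this]
    exact mul_mem (Subgroup.subset_closure (Or.inl ⟨b, rfl⟩))
      (Subgroup.subset_closure (Or.inr ⟨_, rfl⟩))

/-- A gamma function on `ℤ / 2 ^ n`: the unit `γ g` stands for the automorphism `x ↦ γ g * x`, and
`map_mul` says that the maps `x ↦ γ g * x + g` are closed under composition. -/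
structure IsGamma {n : ℕ} (γ : ZMod (2 ^ n) → ZMod (2 ^ n)) : Prop where
  map_zero : γ 0 = 1
  isUnit (g : ZMod (2 ^ n)) : IsUnit (γ g)
  map_mul (g h : ZMod (2 ^ n)) : γ (g + γ g * h) = γ g * γ h

/-- The group generated by the permutations of the form `x ↦ γ g * x + g`; it consists of these
permutations if `γ` is a gamma function. -/
def gammaSubgroup {n : ℕ} (γ : ZMod (2 ^ n) → ZMod (2 ^ n)) :
    Subgroup (Equiv.Perm (ZMod (2 ^ n))) :=
  Subgroup.closure {p | ∃ g, ∀ x, p x = γ g * x + g}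

namespace IsGamma

variable {n : ℕ} {γ δ : ZMod (2 ^ n) → ZMod (2 ^ n)}

/-- The permutation `x ↦ γ g * x + g`. -/
noncomputable def perm (hγ : IsGamma γ) (g : ZMod (2 ^ n)) : Equiv.Perm (ZMod (2 ^ n)) where
  toFun x := γ g * x + g
  invFun x := Ring.inverse (γ g) * (x - g)
  left_inv x := by
    beta_reduce
    rw [add_sub_cancel_right, ← mul_assoc, Ring.inverse_mul_cancel _ (hγ.isUnit g), one_mul]
  right_inv x := by
    beta_reduce
    rw [← mul_assoc, Ring.mul_inverse_cancel _ (hγ.isUnit g), one_mul, sub_add_cancel]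

theorem perm_apply (hγ : IsGamma γ) (g x : ZMod (2 ^ n)) : hγ.perm g x = γ g * x + g := rfl

theorem perm_mul (hγ : IsGamma γ) (g h : ZMod (2 ^ n)) :
    hγ.perm g * hγ.perm h = hγ.perm (g + γ g * h) := by
  ext1 x
  rw [Equiv.Perm.mul_apply, perm_apply, perm_apply, perm_apply, hγ.map_mul]
  ring

theorem perm_zero (hγ : IsGamma γ) : hγ.perm 0 = 1 := by
  ext1 x
  simp [perm_apply, hγ.map_zero]

theorem perm_apply_zero (hγ : IsGamma γ) (g : ZMod (2 ^ n)) : hγ.perm g 0 = g := by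
  simp [perm_apply]

theorem exists_perm_mul_eq_one (hγ : IsGamma γ) (g : ZMod (2 ^ n)) :
    ∃ h, hγ.perm g * hγ.perm h = 1 :=
  ⟨Ring.inverse (γ g) * -g, by
    rw [perm_mul, ← mul_assoc, Ring.mul_inverse_cancel _ (hγ.isUnit g), one_mul, add_neg_cancel,
      perm_zero]⟩

theorem mem_gammaSubgroup (hγ : IsGamma γ) {p : Equiv.Perm (ZMod (2 ^ n))} :
    p ∈ gammaSubgroup γ ↔ ∃ g, hγ.perm g = p := by
  constructor
  · intro hp
    induction hp using Subgroup.closure_induction with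
    | mem p hp =>
      obtain ⟨g, hg⟩ := hp
      exact ⟨g, by ext1 x; rw [hg, perm_apply]⟩
    | one => exact ⟨0, hγ.perm_zero⟩
    | mul p q _ _ hp hq =>
      obtain ⟨g, rfl⟩ := hp
      obtain ⟨h, rfl⟩ := hq
      exact ⟨_, (hγ.perm_mul g h).symm⟩
    | inv p _ hp =>
      obtain ⟨g, rfl⟩ := hp
      obtain ⟨h, hh⟩ := hγ.exists_perm_mul_eq_one g
      exact ⟨h, eq_inv_of_mul_eq_one_right hh⟩
  · rintro ⟨g, rfl⟩
    exact Subgroup.subset_closure ⟨g, fun _ => rfl⟩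

theorem perm_mem (hγ : IsGamma γ) (g : ZMod (2 ^ n)) : hγ.perm g ∈ gammaSubgroup γ :=
  hγ.mem_gammaSubgroup.mpr ⟨g, rfl⟩

theorem gammaSubgroup_injective (hγ : IsGamma γ) (hδ : IsGamma δ)
    (h : gammaSubgroup γ = gammaSubgroup δ) : γ = δ := by
  funext g
  obtain ⟨g', hg⟩ := hδ.mem_gammaSubgroup.mp (h ▸ hγ.perm_mem g)
  have h0 : g' = g := by simpa [perm_apply_zero] using congrArg (fun p => p 0) hg
  subst h0
  simpa [perm_apply] using (congrArg (fun p => p 1) hg).symm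

/-- If a permutation of the form `x ↦ γ g * x + g` fixes a point, then a conjugate of it fixes
`0`, so that it is the identity. -/
theorem gammaSubgroup_mem_regularSubgroups (hγ : IsGamma γ) :
    gammaSubgroup γ ∈ regularSubgroups (ZMod (2 ^ n)) := by
  refine ⟨fun p hp => ?_, fun x y => ?_⟩
  · obtain ⟨g, rfl⟩ := hγ.mem_gammaSubgroup.mp hp
    exact mem_holomorph_iff.mpr ⟨γ g, g, fun _ => rfl⟩
  · have hx := hγ.perm_mem x
    refine ⟨hγ.perm y * (hγ.perm x)⁻¹, ⟨mul_mem (hγ.perm_mem y) (inv_mem hx), ?_⟩, ?_⟩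
    · have : (hγ.perm x)⁻¹ x = 0 := by rw [Equiv.Perm.inv_eq_iff_eq, perm_apply_zero]
      rw [Equiv.Perm.mul_apply, this, perm_apply_zero]
    · rintro p ⟨hp, rfl⟩
      obtain ⟨g, hg⟩ := hγ.mem_gammaSubgroup.mp (mul_mem hp hx)
      have h0 : g = p x := by
        simpa [perm_apply_zero] using congrArg (fun q => q 0) hg
      rw [eq_mul_inv_iff_mul_eq, ← hg, h0]

end IsGamma

/-- Every regular subgroup of the holomorph comes from a gamma function. -/
theorem exists_gammaSubgroup_eq {n : ℕ} {N : Subgroup (Equiv.Perm (ZMod (2 ^ n)))}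
    (hN : N ∈ regularSubgroups (ZMod (2 ^ n))) : ∃ γ, IsGamma γ ∧ gammaSubgroup γ = N := by
  obtain ⟨hle, hreg⟩ := hN
  choose p hp using fun g => (hreg 0 g).exists
  have hpN (g) : p g ∈ N := (hp g).1
  have hp0 (g) : p g 0 = g := (hp g).2
  have huniq {q} (hq : q ∈ N) : q = p (q 0) := (hreg 0 (q 0)).unique ⟨hq, rfl⟩ (hp _)
  have happ (g x) : p g x = (p g 1 - g) * x + g := by
    obtain ⟨a, b, hab⟩ := mem_holomorph_iff.mp (hle (hpN g))
    have h0 := hp0 g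
    rw [hab, mul_zero, zero_add] at h0
    rw [hab x, hab 1, h0]
    ring
  have hγ : IsGamma fun g => p g 1 - g := by
    refine ⟨?_, fun g => ?_, fun g h => ?_⟩
    · have : p 0 = 1 := (huniq (one_mem N)).symm
      simp [this]
    · exact isUnit_of_perm_apply (happ g)
    · have h1 := huniq (mul_mem (hpN g) (hpN h))
      have h0 : (p g * p h) 0 = g + (p g 1 - g) * h := by
        rw [Equiv.Perm.mul_apply, hp0, happ g h, add_comm]
      rw [h0] at h1
      have h2 := congrArg (fun q => q 1) h1
      simp only [Equiv.Perm.mul_apply] at h2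
      rw [← h2, happ g (p h 1)]
      ring
  refine ⟨_, hγ, ?_⟩
  have hperm (g) : hγ.perm g = p g := by
    ext1 x
    rw [hγ.perm_apply, happ g x]
  ext q
  rw [hγ.mem_gammaSubgroup]
  constructor
  · rintro ⟨g, rfl⟩
    exact hperm g ▸ hpN g
  · exact fun hq => ⟨q 0, (hperm _).trans (huniq hq).symm⟩

namespace IsGamma

variable {n : ℕ} {γ : ZMod (2 ^ n) → ZMod (2 ^ n)}

/-- The permutation `x ↦ γ g * x + g`, as an element of the group defined by `γ`. -/
noncomputable def nu (hγ : IsGamma γ) (g : ZMod (2 ^ n)) : gammaSubgroup γ :=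
  ⟨hγ.perm g, hγ.perm_mem g⟩

theorem nu_mul (hγ : IsGamma γ) (g h : ZMod (2 ^ n)) :
    hγ.nu g * hγ.nu h = hγ.nu (g + γ g * h) := Subtype.ext (hγ.perm_mul g h)

theorem nu_zero (hγ : IsGamma γ) : hγ.nu 0 = 1 := Subtype.ext hγ.perm_zero

theorem nu_injective (hγ : IsGamma γ) : Function.Injective hγ.nu := fun g h hgh => by
  simpa [nu, perm_apply_zero] using congrArg (fun p => p.1 0) hgh

theorem nu_surjective (hγ : IsGamma γ) : Function.Surjective hγ.nu := fun p => by
  obtain ⟨g, hg⟩ := hγ.mem_gammaSubgroup.mp p.2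
  exact ⟨g, Subtype.ext hg⟩

theorem nu_inj (hγ : IsGamma γ) {g h : ZMod (2 ^ n)} : hγ.nu g = hγ.nu h ↔ g = h :=
  hγ.nu_injective.eq_iff

theorem nu_eq_one (hγ : IsGamma γ) {g : ZMod (2 ^ n)} : hγ.nu g = 1 ↔ g = 0 := by
  rw [← hγ.nu_zero, nu_inj]

theorem card_gammaSubgroup (hγ : IsGamma γ) : Nat.card (gammaSubgroup γ) = 2 ^ n := by
  rw [← Nat.card_congr (Equiv.ofBijective _ ⟨hγ.nu_injective, hγ.nu_surjective⟩), Nat.card_zmod]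

theorem commute_nu (hγ : IsGamma γ) {g h : ZMod (2 ^ n)} :
    Commute (hγ.nu g) (hγ.nu h) ↔ g + γ g * h = h + γ h * g := by
  rw [commute_iff_eq, nu_mul, nu_mul, nu_inj]

theorem nu_sq (hγ : IsGamma γ) (g : ZMod (2 ^ n)) :
    hγ.nu g ^ 2 = hγ.nu (g + γ g * g) := by rw [sq, nu_mul]

end IsGamma

/-! ### Classification of the gamma functions -/

open ZModTwoPow

open Classical in
/-- The function equal to `1 + c * b` at even `b` and to `1 + c * b + t` at odd `b`. -/
noncomputable def pairGamma {n : ℕ} (c t b : ZMod (2 ^ n)) : ZMod (2 ^ n) :=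
  if Odd b then 1 + c * b + t else 1 + c * b

section pairGamma

variable {n : ℕ} {c t : ZMod (2 ^ n)}

theorem pairGamma_of_odd {b : ZMod (2 ^ n)} (hb : Odd b) : pairGamma c t b = 1 + c * b + t :=
  if_pos hb

theorem pairGamma_of_even (hn : 1 ≤ n) {b : ZMod (2 ^ n)} (hb : Even b) :
    pairGamma c t b = 1 + c * b := if_neg (not_odd_of_even hn hb)

theorem pairGamma_zero_right (b : ZMod (2 ^ n)) : pairGamma c 0 b = 1 + c * b := by
  simp [pairGamma]

theorem pairGamma_one : pairGamma c t 1 = 1 + c + t := by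
  rw [pairGamma_of_odd odd_one, mul_one]

theorem odd_pairGamma (hc : Even c) (ht : Even t) (b : ZMod (2 ^ n)) : Odd (pairGamma c t b) := by
  unfold pairGamma
  split_ifs
  · exact (odd_one.add_even (hc.mul_right b)).add_even ht
  · exact odd_one.add_even (hc.mul_right b)

/-- The parameters `c` and `t` matter only through `2 * c` and `c + t`. -/
theorem pairGamma_add_half (hn : 1 ≤ n) :
    pairGamma (c + 2 ^ (n - 1)) (t + 2 ^ (n - 1)) = pairGamma c t := by
  funext b
  obtain hb | hb := even_or_odd b
  · rw [pairGamma_of_even hn hb, pairGamma_of_even hn hb, add_mul, half_mul_even hn hb, add_zero]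
  · rw [pairGamma_of_odd hb, pairGamma_of_odd hb]
    linear_combination half_mul_odd hn hb + two_mul_half hn

/-- The two equations are the conditions for an even and an odd argument and for two odd
arguments; the remaining cases hold identically. -/
theorem isGamma_pairGamma (hn : 1 ≤ n) (hc : Even c) (ht : Even t) (h1 : 2 * c * t = 0)
    (h2 : t * (2 + c + t) = 0) : IsGamma (pairGamma c t) := by
  refine ⟨?_, fun g => isUnit_of_odd (odd_pairGamma hc ht g), fun g h => ?_⟩
  · rw [pairGamma_of_even hn Even.zero, mul_zero, add_zero]
  · have hodd := odd_pairGamma hc ht g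
    obtain hg | hg := even_or_odd g <;> obtain hh | hh := even_or_odd h
    · rw [pairGamma_of_even hn (hg.add (hh.mul_left _)), pairGamma_of_even hn hg,
        pairGamma_of_even hn hh]
      ring
    · rw [pairGamma_of_odd (hg.add_odd (hodd.mul hh)), pairGamma_of_even hn hg,
        pairGamma_of_odd hh]
      obtain ⟨k, rfl⟩ := hg.two_dvd
      linear_combination -k * h1
    · rw [pairGamma_of_odd (hg.add_even (hh.mul_left _)), pairGamma_of_odd hg,
        pairGamma_of_even hn hh]
      ring
    · rw [pairGamma_of_even hn (hg.add_odd (hodd.mul hh)), pairGamma_of_odd hg,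
        pairGamma_of_odd hh]
      obtain ⟨k, rfl⟩ := hg
      linear_combination -h2 - k * h1

theorem isGamma_pairGamma_zero (hn : 1 ≤ n) (hc : Even c) : IsGamma (pairGamma c 0) :=
  isGamma_pairGamma hn hc Even.zero (by ring) (by ring)

end pairGamma

namespace IsGamma

variable {n : ℕ} {γ : ZMod (2 ^ n) → ZMod (2 ^ n)}

theorem odd (hγ : IsGamma γ) (hn : 1 ≤ n) (g : ZMod (2 ^ n)) : Odd (γ g) :=
  odd_of_isUnit hn (hγ.isUnit g)

/-- If `γ g = 1 + 2 * c * g`, where `c * g` is even, then `γ` is given by the same formula at all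
multiples of `g`. By repeated doubling (squaring in the group) the formula
holds at some `2 ^ j * g * a` with `a` odd, for every `j`. Modulo `2 ^ (j + 1) * g` every element of
`2 ^ j * g * ZMod (2 ^ n)` is zero or this one, so that the claim follows by downward induction
on `j`. -/
theorem apply_mul_of_apply (hγ : IsGamma γ) {c g : ZMod (2 ^ n)} (hcg : Even (c * g))
    (hg : γ g = 1 + 2 * c * g) (x : ZMod (2 ^ n)) : γ (g * x) = 1 + 2 * c * (g * x) := by
  have hdouble (j : ℕ) : ∃ a, Odd a ∧
      γ (2 ^ j * g * a) = 1 + 2 * c * (2 ^ j * g * a) := by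
    induction j with
    | zero => exact ⟨1, odd_one, by simpa using hg⟩
    | succ j ih =>
      obtain ⟨a, ha, h⟩ := ih
      refine ⟨a * (1 + c * g * (2 ^ j * a)), ha.mul (odd_one.add_even (hcg.mul_right _)), ?_⟩
      have hm := hγ.map_mul (2 ^ j * g * a) (2 ^ j * g * a)
      rw [h] at hm
      convert hm using 1
      · congr 1; ring
      · ring
  have hmain (i : ℕ) : ∀ x, γ (2 ^ (n - i) * g * x) = 1 + 2 * c * (2 ^ (n - i) * g * x) := by
    induction i with
    | zero => intro x; simp [two_pow_self, hγ.map_zero]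
    | succ i ih =>
      intro x
      by_cases hi : n ≤ i
      · rw [show n - (i + 1) = n - i by omega]
        exact ih x
      have hi' : (2 : ZMod (2 ^ n)) ^ (n - i) = 2 ^ (n - (i + 1)) * 2 := by
        rw [← pow_succ, show n - (i + 1) + 1 = n - i by omega]
      obtain hx | hx := even_or_odd x
      · obtain ⟨y, rfl⟩ := hx.two_dvd
        convert ih y using 2 <;> rw [hi'] <;> ring
      · obtain ⟨a, ha, h⟩ := hdouble (n - (i + 1))
        obtain ⟨d, hd⟩ := (hx.sub_odd ha).two_dvd
        have hodd : Odd (1 + 2 * c * (2 ^ (n - (i + 1)) * g * a)) :=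
          odd_one.add_even (((even_two_mul c)).mul_right _)
        obtain ⟨y, hy⟩ := exists_mul_eq_of_odd hodd d
        have hm := hγ.map_mul (2 ^ (n - (i + 1)) * g * a) (2 ^ (n - i) * g * y)
        rw [ih, h, hi'] at hm
        have key : 2 ^ (n - (i + 1)) * g * x = 2 ^ (n - (i + 1)) * g * a +
            (1 + 2 * c * (2 ^ (n - (i + 1)) * g * a)) * (2 ^ (n - (i + 1)) * 2 * g * y) := by
          linear_combination 2 ^ (n - (i + 1)) * g * hd - 2 * 2 ^ (n - (i + 1)) * g * hy
        rw [key, hm]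
        ring
  simpa using hmain n x

/-- If `γ` is `1` modulo `4` at an odd element, then `γ` is affine. -/
theorem eq_pairGamma_zero (hγ : IsGamma γ) {g : ZMod (2 ^ n)} (hg : Odd g) (h4 : 4 ∣ γ g - 1) :
    ∃ c, 4 ∣ c ∧ γ = pairGamma c 0 := by
  obtain ⟨k, hk⟩ := h4
  obtain ⟨c, hc⟩ := exists_mul_eq_of_odd hg k
  refine ⟨4 * c, ⟨c, rfl⟩, funext fun b => ?_⟩
  obtain ⟨x, rfl⟩ := exists_mul_eq_of_odd hg b
  rw [hγ.apply_mul_of_apply (c := 2 * c) ⟨c * g, by ring⟩ (by linear_combination hk - 4 * hc),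
    pairGamma_zero_right]
  ring

/-- Every gamma function is a `pairGamma c t`. Unless `γ` is `1` modulo `4` at some odd element, it
is `3` modulo `4` at all of them, hence `1` modulo `4` at `2`; this determines `γ` at the even
elements up to `γ 2`, and at the odd ones up to `γ 2` and `γ 1`. -/
theorem exists_eq_pairGamma (hγ : IsGamma γ) (hn : 1 ≤ n) :
    (∃ c, 4 ∣ c ∧ γ = pairGamma c 0) ∨
    ∃ c t, Even c ∧ Even t ∧ 4 ∣ c + t - 2 ∧ 2 * c * t = 0 ∧ t * (2 + c + t) = 0 ∧
      γ = pairGamma c t := by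
  by_cases hex : ∃ g, Odd g ∧ 4 ∣ γ g - 1
  · obtain ⟨g, hg, h4⟩ := hex
    exact Or.inl (hγ.eq_pairGamma_zero hg h4)
  right
  push Not at hex
  have h3 (g : ZMod (2 ^ n)) (hg : Odd g) : 4 ∣ γ g - 1 - 2 :=
    (four_dvd_or _ ((hγ.odd hn g).sub_odd odd_one)).resolve_left (hex g hg)
  obtain ⟨k, hk⟩ := h3 1 odd_one
  have hodd : Odd (1 + γ 1 * 2) := odd_one.add_even (even_two.mul_left _)
  obtain ⟨l, hl⟩ := h3 _ hodd
  rw [hγ.map_mul] at hl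
  obtain ⟨m, hm⟩ : ∃ m, γ 2 = 1 + 4 * m := by
    obtain ⟨m, hm⟩ := exists_mul_eq_of_odd (hγ.odd hn 1) (l - k)
    exact ⟨m, (isUnit_of_odd (hγ.odd hn 1)).mul_left_cancel
      (by linear_combination hl - hk - 4 * hm)⟩
  have heven (x : ZMod (2 ^ n)) : γ (2 * x) = 1 + 2 * m * (2 * x) :=
    hγ.apply_mul_of_apply ⟨m, by ring⟩ (by rw [hm]; ring) x
  have hc : Even (2 * m) := even_two_mul m
  have ht : Even (γ 1 - 1 - 2 * m) := ((hγ.odd hn 1).sub_odd odd_one).sub hc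
  have hγc : γ = pairGamma (2 * m) (γ 1 - 1 - 2 * m) := by
    funext b
    obtain hb | hb := even_or_odd b
    · obtain ⟨x, rfl⟩ := hb.two_dvd
      rw [heven, pairGamma_of_even hn hb]
    · obtain ⟨d, hd⟩ := hb
      obtain ⟨x, hx⟩ := exists_mul_eq_of_odd (hγ.odd hn 1) d
      have hb' : b = 1 + γ 1 * (2 * x) := by linear_combination hd - 2 * hx
      rw [pairGamma_of_odd ⟨d, hd⟩, hb', hγ.map_mul, heven]
      ring
  refine ⟨2 * m, γ 1 - 1 - 2 * m, hc, ht, ⟨k, by linear_combination hk⟩, ?_, ?_, hγc⟩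
  · have h := hγ.map_mul 2 1
    have ho : Odd (2 + γ 2 * 1) := even_two.add_odd ((hγ.odd hn 2).mul odd_one)
    rw [hm] at h ho
    rw [hγc, pairGamma_of_odd ho, pairGamma_one] at h
    linear_combination -h
  · have h := hγ.map_mul 1 1
    have he : Even (1 + γ 1 * 1) := odd_one.add_odd ((hγ.odd hn 1).mul odd_one)
    obtain ⟨y, hy⟩ := he.two_dvd
    rw [hy, heven, ← hy] at h
    linear_combination -h

end IsGamma

/-! ### The families of regular subgroups -/

/-- The groups of the maps `x ↦ (1 + c * g) * x + g` with `c` divisible by `4`. -/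
def cyclicFamily (n : ℕ) : Set (Subgroup (Equiv.Perm (ZMod (2 ^ n)))) :=
  (fun c => gammaSubgroup (pairGamma c 0)) '' {c | 4 ∣ c}

/-- The groups of the maps `x ↦ (1 + c * g) * x + g` with `c` congruent to `2` modulo `4`. -/
def abelianFamily (n : ℕ) : Set (Subgroup (Equiv.Perm (ZMod (2 ^ n)))) :=
  (fun c => gammaSubgroup (pairGamma c 0)) '' {c | 4 ∣ c - 2}

/-- The regular subgroups that turn out to be modular, for `4 ≤ n`. -/
def modularFamily (n : ℕ) : Set (Subgroup (Equiv.Perm (ZMod (2 ^ n)))) :=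
  (fun c => gammaSubgroup (pairGamma c (2 ^ (n - 2)))) '' {c | 4 ∣ c - 2}

/-- The one regular subgroup that turns out to be dihedral. -/
def dihedralFamily (n : ℕ) : Set (Subgroup (Equiv.Perm (ZMod (2 ^ n)))) :=
  {gammaSubgroup (pairGamma 0 (-2))}

/-- The one regular subgroup that turns out to be quaternion. -/
def quaternionFamily (n : ℕ) : Set (Subgroup (Equiv.Perm (ZMod (2 ^ n)))) :=
  {gammaSubgroup (pairGamma 0 (2 ^ (n - 1) - 2))}

/-- The two regular subgroups that turn out to be semidihedral, for `4 ≤ n`. -/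
def semidihedralFamily (n : ℕ) : Set (Subgroup (Equiv.Perm (ZMod (2 ^ n)))) :=
  {gammaSubgroup (pairGamma (2 ^ (n - 2)) (-2 - 2 ^ (n - 2))),
    gammaSubgroup (pairGamma (2 ^ (n - 2)) (2 ^ (n - 1) - 2 - 2 ^ (n - 2)))}

section

variable {n : ℕ}

theorem even_half (hn : 3 ≤ n) : Even ((2 : ZMod (2 ^ n)) ^ (n - 1)) :=
  even_two.pow_of_ne_zero (by omega)

theorem even_quarter (hn : 3 ≤ n) : Even ((2 : ZMod (2 ^ n)) ^ (n - 2)) :=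
  even_two.pow_of_ne_zero (by omega)

theorem isGamma_abelian (hn : 3 ≤ n) {c : ZMod (2 ^ n)} (hc : 4 ∣ c - 2) :
    IsGamma (pairGamma c 0) :=
  isGamma_pairGamma_zero (by omega) (even_of_four_dvd_sub_two hc)

theorem isGamma_cyclic (hn : 3 ≤ n) {c : ZMod (2 ^ n)} (hc : 4 ∣ c) :
    IsGamma (pairGamma c 0) :=
  isGamma_pairGamma_zero (by omega) (even_of_four_dvd hc)

theorem isGamma_modular (hn : 4 ≤ n) {c : ZMod (2 ^ n)} (hc : 4 ∣ c - 2) :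
    IsGamma (pairGamma c (2 ^ (n - 2))) := by
  have h4 := four_mul_quarter (n := n) (by omega)
  refine isGamma_pairGamma (by omega) (even_of_four_dvd_sub_two hc) (even_quarter (by omega)) ?_ ?_
  · obtain ⟨y, hy, rfl⟩ := exists_odd_of_four_dvd_sub_two hc
    linear_combination y * h4
  · obtain ⟨k, hk⟩ := hc
    obtain ⟨l, hl⟩ := four_dvd_quarter hn
    linear_combination (2 ^ (n - 2)) * hk + (2 ^ (n - 2)) * hl + (1 + k + l) * h4

theorem isGamma_semidihedral (hn : 3 ≤ n) : IsGamma (pairGamma (n := n) (2 ^ (n - 2))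
    (-2 - 2 ^ (n - 2))) := by
  have h4 := four_mul_quarter (n := n) (by omega)
  obtain ⟨k, hk⟩ := (even_quarter hn).two_dvd
  refine isGamma_pairGamma (by omega) (even_quarter hn)
    (even_two.neg.sub (even_quarter hn)) ?_ (by ring)
  linear_combination -h4 - k * h4 - 2 * 2 ^ (n - 2) * hk

theorem isGamma_semidihedral' (hn : 3 ≤ n) : IsGamma (pairGamma (n := n) (2 ^ (n - 2))
    (2 ^ (n - 1) - 2 - 2 ^ (n - 2))) := by
  have h4 := four_mul_quarter (n := n) (by omega)
  have h2 := two_mul_half (n := n) (by omega)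
  obtain ⟨k, hk⟩ := (even_quarter hn).two_dvd
  obtain ⟨l, hl⟩ := (even_half hn).two_dvd
  refine isGamma_pairGamma (by omega) (even_quarter hn)
    (((even_half hn).sub even_two).sub (even_quarter hn)) ?_ ?_
  · linear_combination -h4 - k * h4 - 2 * 2 ^ (n - 2) * hk + 2 ^ (n - 2) * h2
  · linear_combination (l - 1 - k) * h2 + 2 ^ (n - 1) * hl - 2 ^ (n - 1) * hk

theorem isGamma_dihedral (hn : 3 ≤ n) : IsGamma (pairGamma (n := n) 0 (-2)) :=
  isGamma_pairGamma (by omega) Even.zero even_two.neg (by ring) (by ring)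

theorem isGamma_quaternion (hn : 3 ≤ n) : IsGamma (pairGamma (n := n) 0 (2 ^ (n - 1) - 2)) := by
  obtain ⟨l, hl⟩ := (even_half hn).two_dvd
  refine isGamma_pairGamma (by omega) Even.zero ((even_half hn).sub even_two) (by ring) ?_
  linear_combination (l - 1) * two_mul_half (n := n) (by omega) + 2 ^ (n - 1) * hl

theorem four_le_of_four_dvd_quarter (hn : 3 ≤ n) (h : (4 : ZMod (2 ^ n)) ∣ 2 ^ (n - 2)) :
    4 ≤ n := by
  by_contra hlt
  obtain rfl : n = 3 := by omega
  obtain ⟨k, hk⟩ := h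
  exact two_pow_mul_odd_ne_zero (n := 3) (k := 1) (by norm_num) (x := 1 + 2 * -k)
    (odd_one.add_even (even_two_mul _)) (by linear_combination hk)

theorem mem_family_of_mem_regularSubgroups (hn : 3 ≤ n)
    {N : Subgroup (Equiv.Perm (ZMod (2 ^ n)))} (hN : N ∈ regularSubgroups (ZMod (2 ^ n))) :
    N ∈ cyclicFamily n ∨ N ∈ abelianFamily n ∨ N ∈ dihedralFamily n ∨ N ∈ quaternionFamily n ∨
      4 ≤ n ∧ (N ∈ modularFamily n ∨ N ∈ semidihedralFamily n) := by
  obtain ⟨γ, hγ, rfl⟩ := exists_gammaSubgroup_eq hN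
  obtain ⟨c, hc, rfl⟩ | ⟨c, t, hc, ht, h4, h1, h2, rfl⟩ := hγ.exists_eq_pairGamma (by omega)
  · exact Or.inl ⟨c, hc, rfl⟩
  right
  have hhalf := two_mul_half (n := n) (by omega)
  have hshift (c t : ZMod (2 ^ n)) :
      pairGamma (c + 2 ^ (n - 1)) t = pairGamma c (t + 2 ^ (n - 1)) := by
    rw [← pairGamma_add_half (by omega), add_assoc, ← two_mul, hhalf, add_zero]
  obtain hc4 | hc2 := four_dvd_or c hc
  · have ht2 : 4 ∣ t - 2 := by
      have := dvd_sub h4 hc4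
      rwa [show c + t - 2 - c = t - 2 by ring] at this
    obtain ⟨s, hs, rfl⟩ := exists_odd_of_four_dvd_sub_two ht2
    have h4c : 4 * c = 0 := odd_mul_eq_zero hs (by linear_combination h1)
    have h2t : 2 * (2 + c + 2 * s) = 0 := odd_mul_eq_zero hs (by linear_combination h2)
    have ht' : 2 * s = -2 - c ∨ 2 * s = 2 ^ (n - 1) - 2 - c :=
      (two_mul_eq_zero (by omega) h2t).imp (fun h => by linear_combination h)
        (fun h => by linear_combination h)
    have hhalf4 := four_dvd_half hn
    -- replacing `c` by `c + 2 ^ (n - 1)` exchanges the two values of `t`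
    obtain h | h | h | h := four_mul_eq_zero (by omega) h4c
    · subst h
      obtain ht | ht := ht' <;> rw [ht]
      · right; left; simp [dihedralFamily]
      · right; right; left; simp [quaternionFamily]
    · obtain ht | ht := ht' <;> rw [ht, h]
      · right; left
        have := hshift 0 (-2 - 2 ^ (n - 1))
        rw [zero_add, sub_add_cancel] at this
        rw [this]; rfl
      · right; right; left
        have := hshift 0 (-2)
        rw [zero_add] at this
        rw [show (2 : ZMod (2 ^ n)) ^ (n - 1) - 2 - 2 ^ (n - 1) = -2 by ring, this,
          neg_add_eq_sub]
        rfl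
    · have hn4 : 4 ≤ n := four_le_of_four_dvd_quarter hn (h ▸ hc4)
      obtain ht | ht := ht' <;> rw [ht, h] <;>
        exact Or.inr (Or.inr (Or.inr ⟨hn4, by simp [semidihedralFamily]⟩))
    · have hn4 : 4 ≤ n := by
        refine four_le_of_four_dvd_quarter hn ?_
        have := dvd_sub hc4 hhalf4
        rwa [h, add_sub_cancel_right] at this
      right; right; right
      refine ⟨hn4, Or.inr ?_⟩
      obtain ht | ht := ht' <;> rw [ht, h, hshift]
      · left; congr 2; ring
      · right; congr 2; ring
  · have ht4 : 4 ∣ t := by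
      have := dvd_sub h4 hc2
      rwa [show c + t - 2 - (c - 2) = t by ring] at this
    obtain ⟨d, hd, rfl⟩ := exists_odd_of_four_dvd_sub_two hc2
    have h4t : 4 * t = 0 := odd_mul_eq_zero hd (by linear_combination h1)
    have hhalf4 := four_dvd_half hn
    have hc2' : 4 ∣ 2 * d + 2 ^ (n - 1) - 2 := by
      have := dvd_add hc2 hhalf4
      rwa [show 2 * d - 2 + 2 ^ (n - 1) = 2 * d + 2 ^ (n - 1) - 2 by ring] at this
    obtain rfl | rfl | rfl | rfl := four_mul_eq_zero (by omega) h4t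
    · exact Or.inl ⟨_, hc2, rfl⟩
    · refine Or.inl ⟨_, hc2', ?_⟩
      have := hshift (2 * d) 0
      rw [zero_add] at this
      exact congrArg gammaSubgroup this
    · exact Or.inr (Or.inr (Or.inr ⟨four_le_of_four_dvd_quarter hn ht4, Or.inl ⟨_, hc2, rfl⟩⟩))
    · have hn4 : 4 ≤ n := by
        refine four_le_of_four_dvd_quarter hn ?_
        have := dvd_sub ht4 hhalf4
        rwa [add_sub_cancel_right] at this
      exact Or.inr (Or.inr (Or.inr ⟨hn4, Or.inl ⟨_, hc2', congrArg gammaSubgroup (hshift _ _)⟩⟩))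

end

/-! ### Groups with a cyclic subgroup of index two -/

/-- The elements `x` and `y` generate `G`, satisfy `x ^ m = 1`, `y ^ 2 = x ^ f` and
`x * y = y * x ^ e`, and `G` has the largest order that these relations allow. -/
structure IsMetacyclicPair {G : Type*} [Group G] (m e f : ℕ) (x y : G) : Prop where
  pow_eq_one : x ^ m = 1
  sq_eq : y ^ 2 = x ^ f
  mul_eq : x * y = y * x ^ e
  closure_eq_top : Subgroup.closure {x, y} = ⊤
  card_eq : Nat.card G = 2 * m

theorem card_le_of_metacyclic {G : Type*} [Group G] {m e f : ℕ} (hm : 0 < m) {x y : G}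
    (hx : x ^ m = 1) (hy : y ^ 2 = x ^ f) (hxy : x * y = y * x ^ e)
    (hcl : Subgroup.closure {x, y} = ⊤) : Finite G ∧ Nat.card G ≤ 2 * m := by
  have hpow (k : ℕ) : x ^ k * y = y * x ^ (e * k) := by
    induction k with
    | zero => simp
    | succ k ih => rw [pow_succ, mul_assoc, hxy, ← mul_assoc, ih, mul_assoc, ← pow_add, mul_add_one]
  have hinv (k : ℕ) : ∃ l, (x ^ k)⁻¹ = x ^ l := by
    refine ⟨k * (m - 1), ?_⟩
    rw [inv_eq_iff_mul_eq_one, ← pow_add, show k + k * (m - 1) = m * k by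
      obtain ⟨m, rfl⟩ := Nat.exists_eq_add_of_lt hm; simp; ring, pow_mul, hx, one_pow]
  have hmem (g : G) : ∃ k, g = x ^ k ∨ g = y * x ^ k := by
    have hg : g ∈ Subgroup.closure {x, y} := hcl ▸ Subgroup.mem_top g
    have hmul {a b : G} (ha : ∃ k, a = x ^ k ∨ a = y * x ^ k)
        (hb : ∃ k, b = x ^ k ∨ b = y * x ^ k) : ∃ k, a * b = x ^ k ∨ a * b = y * x ^ k := by
      obtain ⟨k, rfl | rfl⟩ := ha <;> obtain ⟨l, rfl | rfl⟩ := hb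
      · exact ⟨k + l, Or.inl (pow_add _ _ _).symm⟩
      · exact ⟨e * k + l, Or.inr (by rw [← mul_assoc, hpow, mul_assoc, ← pow_add])⟩
      · exact ⟨k + l, Or.inr (by rw [mul_assoc, ← pow_add])⟩
      · exact ⟨f + (e * k + l), Or.inl (by
          rw [mul_assoc, ← mul_assoc (x ^ k), hpow, mul_assoc, ← pow_add, ← mul_assoc, ← sq, hy,
            ← pow_add])⟩
    induction hg using Subgroup.closure_induction with
    | mem a ha =>
      obtain rfl | rfl := ha
      · exact ⟨1, Or.inl (pow_one _).symm⟩
      · exact ⟨0, Or.inr (by simp)⟩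
    | one => exact ⟨0, Or.inl (by simp)⟩
    | mul a b _ _ ha hb => exact hmul ha hb
    | inv a _ ha =>
      obtain ⟨k, rfl | rfl⟩ := ha
      · obtain ⟨l, hl⟩ := hinv k
        exact ⟨l, Or.inl hl⟩
      · obtain ⟨l, hl⟩ := hinv k
        obtain ⟨l', hl'⟩ := hinv f
        -- the inverse of `y` is `y * (x ^ f)⁻¹`
        have hyinv : y⁻¹ = y * x ^ l' := by
          rw [inv_eq_iff_mul_eq_one, ← mul_assoc, ← sq, hy, ← hl', mul_inv_cancel]
        rw [mul_inv_rev, hl, hyinv]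
        exact hmul ⟨l, Or.inl rfl⟩ ⟨l', Or.inr rfl⟩
  have hsurj : Function.Surjective
      (fun p : Fin 2 × Fin m => if p.1 = 0 then x ^ (p.2 : ℕ) else y * x ^ (p.2 : ℕ)) := by
    intro g
    obtain ⟨k, hk⟩ := hmem g
    have hk' : x ^ k = x ^ (k % m) := by
      conv_lhs => rw [← Nat.mod_add_div k m, pow_add, pow_mul, hx, one_pow, mul_one]
    rw [hk'] at hk
    obtain rfl | rfl := hk
    · exact ⟨(0, ⟨k % m, Nat.mod_lt _ hm⟩), by simp⟩
    · exact ⟨(1, ⟨k % m, Nat.mod_lt _ hm⟩), by simp⟩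
  refine ⟨Finite.of_surjective _ hsurj, ?_⟩
  simpa using Nat.card_le_card_of_surjective _ hsurj

/-- A group that satisfies the relations of a metacyclic pair is isomorphic to the group of that
pair as soon as it maps onto it, since it cannot be larger. -/
theorem IsMetacyclicPair.nonempty_mulEquiv_of_hom {G P : Type*} [Group G] [Group P] {m e f : ℕ}
    (hm : 0 < m) {x y : G} (h : IsMetacyclicPair m e f x y) {a b : P} (ha : a ^ m = 1)
    (hb : b ^ 2 = a ^ f) (hab : a * b = b * a ^ e) (hcl : Subgroup.closure {a, b} = ⊤)
    (φ : P →* G) (hφa : φ a = x) (hφb : φ b = y) : Nonempty (G ≃* P) := by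
  obtain ⟨hfin, hcard⟩ := card_le_of_metacyclic hm ha hb hab hcl
  have hsurj : Function.Surjective φ := by
    rw [← MonoidHom.range_eq_top, eq_top_iff, ← h.closure_eq_top, Subgroup.closure_le]
    rintro _ (rfl | rfl)
    · exact ⟨a, hφa⟩
    · exact ⟨b, hφb⟩
  have hbij : Function.Bijective φ := by
    refine (Nat.bijective_iff_surjective_and_card φ).mpr ⟨hsurj, le_antisymm ?_ ?_⟩
    · rw [h.card_eq]; exact hcard
    · exact Nat.card_le_card_of_surjective φ hsurj
  exact ⟨(MulEquiv.ofBijective φ hbij).symm⟩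

theorem closure_presentedGroup_pair {rels : Set (FreeGroup (Fin 2))} :
    Subgroup.closure {(PresentedGroup.of 0 : PresentedGroup rels), PresentedGroup.of 1} = ⊤ := by
  rw [← PresentedGroup.closure_range_of rels]
  congr 1
  ext g
  simp [Fin.exists_fin_two, eq_comm]

/-- The relators of the presentation by a metacyclic pair. -/
def metacyclicPairRelators (m e f : ℕ) : Set (FreeGroup (Fin 2)) :=
  {FreeGroup.of 0 ^ m, FreeGroup.of 1 ^ 2 * (FreeGroup.of 0 ^ f)⁻¹,
    FreeGroup.of 0 * FreeGroup.of 1 * (FreeGroup.of 1 * FreeGroup.of 0 ^ e)⁻¹}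

theorem IsMetacyclicPair.nonempty_mulEquiv_presentedGroup_pair {G : Type*} [Group G] {m e f : ℕ}
    (hm : 0 < m) {x y : G} (h : IsMetacyclicPair m e f x y) :
    Nonempty (G ≃* PresentedGroup (metacyclicPairRelators m e f)) := by
  have hrels : ∀ r ∈ metacyclicPairRelators m e f, FreeGroup.lift ![x, y] r = 1 := by
    rintro _ (rfl | rfl | rfl)
    · simpa using h.pow_eq_one
    · simpa [mul_inv_eq_one] using h.sq_eq
    · simp only [map_mul, map_inv, map_pow, FreeGroup.lift_apply_of, mul_inv_eq_one]
      exact h.mul_eq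
  exact h.nonempty_mulEquiv_of_hom hm
    (a := (PresentedGroup.of 0 : PresentedGroup (metacyclicPairRelators m e f)))
    (b := PresentedGroup.of 1)
    (PresentedGroup.one_of_mem (rels := metacyclicPairRelators m e f) (Or.inl rfl))
    (mul_inv_eq_one.mp (PresentedGroup.one_of_mem (rels := metacyclicPairRelators m e f)
      (Or.inr (Or.inl rfl))))
    (mul_inv_eq_one.mp (PresentedGroup.one_of_mem (rels := metacyclicPairRelators m e f)
      (Or.inr (Or.inr rfl))))
    closure_presentedGroup_pair (PresentedGroup.toGroup hrels) (by simp) (by simp)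

theorem IsMetacyclicPair.nonempty_mulEquiv {G H : Type*} [Group G] [Group H] {m e f : ℕ}
    (hm : 0 < m) {x y : G} (h : IsMetacyclicPair m e f x y) {x' y' : H}
    (h' : IsMetacyclicPair m e f x' y') : Nonempty (G ≃* H) := by
  obtain ⟨φ⟩ := h.nonempty_mulEquiv_presentedGroup_pair hm
  obtain ⟨ψ⟩ := h'.nonempty_mulEquiv_presentedGroup_pair hm
  exact ⟨φ.trans ψ.symm⟩

theorem IsMetacyclicPair.nonempty_mulEquiv_presentedGroup {G : Type*} [Group G] {n e : ℕ}
    {x y : G} (h : IsMetacyclicPair (2 ^ (n - 1)) e 0 x y) :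
    Nonempty (G ≃* PresentedGroup (metacyclicRelators n e)) := by
  let rels := metacyclicRelators n e
  let a : PresentedGroup rels := PresentedGroup.of 0
  let b : PresentedGroup rels := PresentedGroup.of 1
  have ha : a ^ 2 ^ (n - 1) = 1 := PresentedGroup.one_of_mem (rels := rels) (Or.inl rfl)
  have hb : b ^ 2 = 1 := PresentedGroup.one_of_mem (rels := rels) (Or.inr (Or.inl rfl))
  have hab : b⁻¹ * a * b = a ^ e :=
    mul_inv_eq_one.mp (PresentedGroup.one_of_mem (rels := rels) (Or.inr (Or.inr rfl)))
  have hrels : ∀ r ∈ rels, FreeGroup.lift ![x, y] r = 1 := by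
    rintro _ (rfl | rfl | rfl)
    · simpa using h.pow_eq_one
    · simpa using h.sq_eq
    · simp only [map_mul, map_inv, map_pow, FreeGroup.lift_apply_of, mul_inv_eq_one]
      simp [mul_assoc, h.mul_eq]
  exact h.nonempty_mulEquiv_of_hom (by positivity) ha (by simpa using hb)
    (by rw [← hab, mul_assoc, mul_inv_cancel_left]) closure_presentedGroup_pair
    (PresentedGroup.toGroup hrels) (by simp [a]) (by simp)

theorem isMetacyclicPair_dihedralGroup (m : ℕ) [NeZero m] :
    IsMetacyclicPair m (m - 1) 0 (DihedralGroup.r 1 : DihedralGroup m) (DihedralGroup.sr 0) where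
  pow_eq_one := by simp
  sq_eq := by simp [sq]
  mul_eq := by simp [Nat.cast_sub (NeZero.one_le (n := m))]
  closure_eq_top := by
    have hr (i : ZMod m) : DihedralGroup.r i ∈
        Subgroup.closure {(DihedralGroup.r 1 : DihedralGroup m), DihedralGroup.sr 0} := by
      have := pow_mem (Subgroup.subset_closure (Or.inl rfl) : DihedralGroup.r 1 ∈
        Subgroup.closure {(DihedralGroup.r 1 : DihedralGroup m), DihedralGroup.sr 0}) i.val
      rwa [DihedralGroup.r_one_pow, ZMod.natCast_zmod_val] at this
    rw [eq_top_iff]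
    rintro (i | i) -
    · exact hr i
    · have := mul_mem (Subgroup.subset_closure (Or.inr rfl) : DihedralGroup.sr 0 ∈
        Subgroup.closure {(DihedralGroup.r 1 : DihedralGroup m), DihedralGroup.sr 0}) (hr i)
      rwa [DihedralGroup.sr_mul_r, zero_add] at this
  card_eq := DihedralGroup.nat_card

theorem isMetacyclicPair_quaternionGroup (k : ℕ) [NeZero k] :
    IsMetacyclicPair (2 * k) (2 * k - 1) k (QuaternionGroup.a 1 : QuaternionGroup k)
      (QuaternionGroup.xa 0) where
  pow_eq_one := by simp
  sq_eq := by simp [sq]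
  mul_eq := by simp [Nat.cast_sub (NeZero.one_le (n := 2 * k))]
  closure_eq_top := by
    have hr (i : ZMod (2 * k)) : QuaternionGroup.a i ∈
        Subgroup.closure {(QuaternionGroup.a 1 : QuaternionGroup k), QuaternionGroup.xa 0} := by
      have := pow_mem (Subgroup.subset_closure (Or.inl rfl) : QuaternionGroup.a 1 ∈
        Subgroup.closure {(QuaternionGroup.a 1 : QuaternionGroup k), QuaternionGroup.xa 0}) i.val
      rwa [QuaternionGroup.a_one_pow, ZMod.natCast_zmod_val] at this
    rw [eq_top_iff]
    rintro (i | i) -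
    · exact hr i
    · have := mul_mem (Subgroup.subset_closure (Or.inr rfl) : QuaternionGroup.xa 0 ∈
        Subgroup.closure {(QuaternionGroup.a 1 : QuaternionGroup k), QuaternionGroup.xa 0}) (hr i)
      rwa [QuaternionGroup.xa_mul_a, zero_add] at this
  card_eq := by rw [Nat.card_eq_fintype_card, QuaternionGroup.card]; ring

theorem isMetacyclicPair_prod (m : ℕ) [NeZero m] :
    IsMetacyclicPair m 1 0
      ((1, Multiplicative.ofAdd 1) : Multiplicative (ZMod 2) × Multiplicative (ZMod m))
      (Multiplicative.ofAdd 1, 1) where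
  pow_eq_one := by
    ext
    · simp
    · simp [← ofAdd_nsmul]
  sq_eq := by
    ext
    · simp only [Prod.pow_fst, pow_zero, Prod.fst_one]; decide
    · simp
  mul_eq := by simp
  closure_eq_top := by
    rw [eq_top_iff]
    rintro ⟨i, j⟩ -
    have h1 := pow_mem (Subgroup.subset_closure (Or.inl rfl) : (1, Multiplicative.ofAdd 1) ∈
      Subgroup.closure {((1, Multiplicative.ofAdd 1) :
        Multiplicative (ZMod 2) × Multiplicative (ZMod m)), (Multiplicative.ofAdd 1, 1)})
      j.toAdd.val
    have h2 := pow_mem (Subgroup.subset_closure (Or.inr rfl) : (Multiplicative.ofAdd 1, 1) ∈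
      Subgroup.closure {((1, Multiplicative.ofAdd 1) :
        Multiplicative (ZMod 2) × Multiplicative (ZMod m)), (Multiplicative.ofAdd 1, 1)})
      i.toAdd.val
    convert mul_mem h1 h2 using 1
    ext <;> simp [← ofAdd_nsmul]
  card_eq := by simp

/-! ### The isomorphism types of the families -/

namespace IsGamma

variable {n : ℕ} {γ : ZMod (2 ^ n) → ZMod (2 ^ n)}

theorem nu_pow_two_pow (hγ : IsGamma γ) {d g : ZMod (2 ^ n)} (hdg : Even (d * g))
    (hg : ∀ x, γ (g * x) = 1 + 2 * d * (g * x)) (j : ℕ) :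
    ∃ a, Odd a ∧ hγ.nu g ^ 2 ^ j = hγ.nu (2 ^ j * (g * a)) := by
  induction j with
  | zero => exact ⟨1, odd_one, by simp⟩
  | succ j ih =>
    obtain ⟨a, ha, h⟩ := ih
    refine ⟨a * (1 + d * g * (2 ^ j * a)), ha.mul (odd_one.add_even (hdg.mul_right _)), ?_⟩
    rw [pow_succ, pow_mul, h, nu_sq, nu_inj,
      show 2 ^ j * (g * a) = g * (2 ^ j * a) by ring, hg]
    ring

theorem orderOf_nu (hγ : IsGamma γ) {d g : ZMod (2 ^ n)} (hdg : Even (d * g))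
    (hg : ∀ x, γ (g * x) = 1 + 2 * d * (g * x)) {k : ℕ} (h0 : 2 ^ (k + 1) * g = 0)
    (h1 : 2 ^ k * g ≠ 0) : orderOf (hγ.nu g) = 2 ^ (k + 1) := by
  have : Fact (Nat.Prime 2) := ⟨Nat.prime_two⟩
  refine orderOf_eq_prime_pow (fun h => ?_) ?_
  · obtain ⟨a, ha, h'⟩ := hγ.nu_pow_two_pow hdg hg k
    rw [h', nu_eq_one] at h
    exact h1 (odd_mul_eq_zero ha (by linear_combination h))
  · obtain ⟨a, ha, h'⟩ := hγ.nu_pow_two_pow hdg hg (k + 1)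
    rw [h', nu_eq_one]
    linear_combination a * h0

end IsGamma

section

variable {n : ℕ} {c t : ZMod (2 ^ n)}

theorem orderOf_nu_two (hn : 3 ≤ n) (hγ : IsGamma (pairGamma c t)) (hc : Even c) :
    orderOf (hγ.nu 2) = 2 ^ (n - 1) := by
  obtain ⟨d, rfl⟩ := hc.two_dvd
  have h := hγ.orderOf_nu (d := d) (g := 2) (k := n - 2) (even_two.mul_left _)
    (fun x => pairGamma_of_even (by omega) (even_two_mul x))
    (by rw [show n - 2 + 1 = n - 1 by omega, mul_comm, two_mul_half (by omega)])
    (by rw [mul_comm, two_mul_quarter (by omega)]; exact two_pow_ne_zero (by omega))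
  rwa [show n - 2 + 1 = n - 1 by omega] at h

theorem nu_two_pow_quarter (hn : 3 ≤ n) (hγ : IsGamma (pairGamma c t)) (hc : Even c) :
    hγ.nu 2 ^ 2 ^ (n - 2) = hγ.nu (2 ^ (n - 1)) := by
  obtain ⟨d, rfl⟩ := hc.two_dvd
  obtain ⟨a, ha, h⟩ := hγ.nu_pow_two_pow (d := d) (g := 2) (even_two.mul_left _)
    (fun x => pairGamma_of_even (by omega) (even_two_mul x)) (n - 2)
  rw [h, ← mul_assoc, mul_comm _ 2, two_mul_quarter (by omega), half_mul_odd (by omega) ha]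

/-- If `4 * c = 0` then the powers of `ν(2)` are given by multiplication. -/
theorem nu_two_pow (hn : 1 ≤ n) (hγ : IsGamma (pairGamma c t)) (hc : 4 * c = 0) (k : ℕ) :
    hγ.nu 2 ^ k = hγ.nu (2 * k) := by
  induction k with
  | zero => simp [hγ.nu_zero]
  | succ k ih =>
    rw [pow_succ, ih, hγ.nu_mul, hγ.nu_inj, pairGamma_of_even hn (even_two_mul _)]
    push_cast
    linear_combination k * hc

theorem nu_two_mul_nu (hn : 1 ≤ n) (hγ : IsGamma (pairGamma c t)) (g : ZMod (2 ^ n)) :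
    hγ.nu 2 * hγ.nu g = hγ.nu (2 + (1 + 2 * c) * g) := by
  rw [hγ.nu_mul, pairGamma_of_even hn even_two, mul_comm c]

theorem nu_mul_nu_of_odd (hγ : IsGamma (pairGamma c t)) {g : ZMod (2 ^ n)} (hg : Odd g)
    (h : ZMod (2 ^ n)) : hγ.nu g * hγ.nu h = hγ.nu (g + (1 + c * g + t) * h) := by
  rw [hγ.nu_mul, pairGamma_of_odd hg]

/-- The powers of `ν(2)` are half of the group, and `ν(g)` is not among them for odd `g`. -/
theorem closure_nu_pair (hn : 3 ≤ n) (hγ : IsGamma (pairGamma c t)) (hc : Even c)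
    {g : ZMod (2 ^ n)} (hg : Odd g) : Subgroup.closure {hγ.nu 2, hγ.nu g} = ⊤ := by
  have hfin : Finite (gammaSubgroup (pairGamma c t)) := Finite.of_surjective _ hγ.nu_surjective
  set H := Subgroup.closure {hγ.nu 2, hγ.nu g}
  have hle : Subgroup.zpowers (hγ.nu 2) ≤ H := by
    rw [Subgroup.zpowers_le]
    exact Subgroup.subset_closure (Or.inl rfl)
  have hgH : hγ.nu g ∈ H := Subgroup.subset_closure (Or.inr rfl)
  have hcard : Nat.card (Subgroup.zpowers (hγ.nu 2)) = 2 ^ (n - 1) := by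
    rw [Nat.card_zpowers, orderOf_nu_two hn hγ hc]
  have hnot : hγ.nu g ∉ Subgroup.zpowers (hγ.nu 2) := by
    rw [mem_zpowers_iff_mem_range_orderOf]
    intro hmem
    obtain ⟨k, -, hk⟩ := Finset.mem_image.mp hmem
    have heven : ∀ k : ℕ, ∃ x, Even x ∧ hγ.nu 2 ^ k = hγ.nu x := by
      intro k
      induction k with
      | zero => exact ⟨0, Even.zero, by simp [hγ.nu_zero]⟩
      | succ k ih =>
        obtain ⟨x, hx, h⟩ := ih
        exact ⟨_, hx.add (even_two.mul_left _), by rw [pow_succ, h, hγ.nu_mul]⟩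
    obtain ⟨x, hx, h⟩ := heven k
    rw [h, hγ.nu_inj] at hk
    exact not_even_of_odd (by omega) hg (hk ▸ hx)
  have hdvd := H.card_subgroup_dvd_card
  rw [hγ.card_gammaSubgroup, Nat.dvd_prime_pow Nat.prime_two] at hdvd
  obtain ⟨m, hm, hHm⟩ := hdvd
  have hmn : m = n := by
    by_contra hne
    refine hnot ((Subgroup.eq_of_le_of_card_ge hle ?_).symm ▸ hgH)
    rw [hcard, hHm]
    exact Nat.pow_le_pow_right (by norm_num) (by omega)
  exact Subgroup.eq_top_of_card_eq H (by rw [hHm, hmn, hγ.card_gammaSubgroup])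

theorem isMetacyclicPair_nu (hn : 3 ≤ n) (hγ : IsGamma (pairGamma c t)) (hc : Even c)
    {g : ZMod (2 ^ n)} (hg : Odd g) {e f : ℕ} (hf : hγ.nu g ^ 2 = hγ.nu 2 ^ f)
    (he : hγ.nu 2 * hγ.nu g = hγ.nu g * hγ.nu 2 ^ e) :
    IsMetacyclicPair (2 ^ (n - 1)) e f (hγ.nu 2) (hγ.nu g) where
  pow_eq_one := by rw [← orderOf_nu_two hn hγ hc, pow_orderOf_eq_one]
  sq_eq := hf
  mul_eq := he
  closure_eq_top := closure_nu_pair hn hγ hc hg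
  card_eq := by rw [hγ.card_gammaSubgroup, ← pow_succ', Nat.sub_add_cancel (by omega)]

theorem nu_sq_of_odd (hγ : IsGamma (pairGamma c t)) {g : ZMod (2 ^ n)} (hg : Odd g) :
    hγ.nu g ^ 2 = hγ.nu (g * (2 + c * g + t)) := by
  rw [sq, nu_mul_nu_of_odd hγ hg]
  congr 1
  ring

theorem isCyclic_of_mem_cyclicFamily (hn : 3 ≤ n) {N : Subgroup (Equiv.Perm (ZMod (2 ^ n)))}
    (hN : N ∈ cyclicFamily n) : IsCyclic N := by
  obtain ⟨c, ⟨d, rfl⟩, rfl⟩ := hN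
  have hγ := isGamma_cyclic hn (c := 4 * d) ⟨d, rfl⟩
  have : Finite (gammaSubgroup (pairGamma (4 * d) 0)) := Finite.of_surjective _ hγ.nu_surjective
  have horder : orderOf (hγ.nu 1) = 2 ^ (n - 1 + 1) :=
    hγ.orderOf_nu (d := 2 * d) (by rw [mul_one]; exact even_two_mul d)
      (fun x => by rw [pairGamma_zero_right]; ring)
      (by rw [Nat.sub_add_cancel (by omega), two_pow_self, zero_mul])
      (by rw [mul_one]; exact two_pow_ne_zero (by omega))
  refine isCyclic_of_orderOf_eq_card (hγ.nu 1) ?_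
  rw [horder, hγ.card_gammaSubgroup, Nat.sub_add_cancel (by omega)]

theorem exists_odd_mul_eq {d y : ZMod (2 ^ n)} (hn : 1 ≤ n) (hd : Odd d) (hy : Odd y) :
    ∃ g, Odd g ∧ d * g = y := by
  obtain ⟨g, rfl⟩ := exists_mul_eq_of_odd hd y
  refine ⟨g, (even_or_odd g).resolve_left fun h => ?_, rfl⟩
  exact not_even_of_odd hn hy (h.mul_left _)

theorem isMetacyclicPair_abelian (hn : 3 ≤ n) (hc : 4 ∣ c - 2) :
    ∃ x y : gammaSubgroup (pairGamma c 0), IsMetacyclicPair (2 ^ (n - 1)) 1 0 x y := by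
  have hγ := isGamma_abelian hn hc
  obtain ⟨d, hd, rfl⟩ := exists_odd_of_four_dvd_sub_two hc
  obtain ⟨g, hg, hdg⟩ := exists_odd_mul_eq (by omega) hd odd_one.neg
  refine ⟨_, _, isMetacyclicPair_nu hn hγ (even_two_mul d) hg ?_ ?_⟩
  · rw [nu_sq_of_odd hγ hg, pow_zero, hγ.nu_eq_one]
    linear_combination 2 * g * hdg
  · rw [pow_one, nu_two_mul_nu (by omega), nu_mul_nu_of_odd hγ hg]
    congr 1
    ring

/-- The witnesses are `ν(2)` and an involution `ν(g)` with `g` odd. -/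
theorem isMetacyclicPair_modular (hn : 4 ≤ n) (hc : 4 ∣ c - 2) :
    ∃ x y : gammaSubgroup (pairGamma c (2 ^ (n - 2))),
      IsMetacyclicPair (2 ^ (n - 1)) (2 ^ (n - 2) + 1) 0 x y := by
  have hγ := isGamma_modular hn hc
  obtain ⟨d, hd, rfl⟩ := exists_odd_of_four_dvd_sub_two hc
  obtain ⟨q, hq⟩ := four_dvd_quarter hn
  obtain ⟨g, hg, hdg⟩ := exists_odd_mul_eq (y := -1 - 2 * q) (by omega) hd
    (odd_one.neg.sub_even (even_two_mul q))
  refine ⟨_, _, isMetacyclicPair_nu (by omega) hγ (even_two_mul d) hg ?_ ?_⟩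
  · rw [nu_sq_of_odd hγ hg, pow_zero, hγ.nu_eq_one]
    linear_combination 2 * g * hdg + g * hq
  · have hhalf : 2 ^ (n - 1) * (2 * d) = 0 := half_mul_even (by omega) (even_two_mul d)
    have hh : pairGamma (2 * d) (2 ^ (n - 2)) (2 ^ (n - 1)) = 1 := by
      rw [pairGamma_of_even (by omega) (even_half (by omega)), mul_comm, hhalf, add_zero]
    rw [pow_succ, nu_two_pow_quarter (by omega) hγ (even_two_mul d), hγ.nu_mul (2 ^ (n - 1)), hh,
      nu_two_mul_nu (by omega), nu_mul_nu_of_odd hγ hg]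
    congr 1
    have h2 := two_mul_quarter (n := n) (by omega)
    have h3 := half_mul_even (n := n) (by omega) (even_quarter (n := n) (by omega))
    linear_combination -h2 - g * hhalf - h3 - two_mul_half (n := n) (by omega)

theorem isMetacyclicPair_dihedral (hn : 3 ≤ n) :
    ∃ x y : gammaSubgroup (pairGamma (n := n) 0 (-2)),
      IsMetacyclicPair (2 ^ (n - 1)) (2 ^ (n - 1) - 1) 0 x y := by
  have hγ := isGamma_dihedral hn
  refine ⟨_, _, isMetacyclicPair_nu hn hγ Even.zero odd_one ?_ ?_⟩
  · rw [nu_sq_of_odd hγ odd_one, pow_zero, hγ.nu_eq_one]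
    ring
  · rw [nu_two_pow (by omega) hγ (mul_zero _), nu_two_mul_nu (by omega),
      nu_mul_nu_of_odd hγ odd_one, Nat.cast_sub Nat.one_le_two_pow]
    push_cast
    congr 1
    linear_combination two_mul_half (n := n) (by omega)

theorem isMetacyclicPair_quaternion (hn : 3 ≤ n) :
    ∃ x y : gammaSubgroup (pairGamma (n := n) 0 (2 ^ (n - 1) - 2)),
      IsMetacyclicPair (2 ^ (n - 1)) (2 ^ (n - 1) - 1) (2 ^ (n - 2)) x y := by
  have hγ := isGamma_quaternion hn
  refine ⟨_, _, isMetacyclicPair_nu hn hγ Even.zero odd_one ?_ ?_⟩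
  · rw [nu_sq_of_odd hγ odd_one, nu_two_pow_quarter hn hγ Even.zero]
    congr 1
    ring
  · rw [nu_two_pow (by omega) hγ (mul_zero _), nu_two_mul_nu (by omega),
      nu_mul_nu_of_odd hγ odd_one, Nat.cast_sub Nat.one_le_two_pow]
    push_cast
    congr 1
    linear_combination (2 - 2 ^ (n - 1)) * two_mul_half (n := n) (by omega)

theorem isMetacyclicPair_semidihedral (hn : 3 ≤ n) :
    ∃ x y : gammaSubgroup (pairGamma (n := n) (2 ^ (n - 2)) (-2 - 2 ^ (n - 2))),
      IsMetacyclicPair (2 ^ (n - 1)) (2 ^ (n - 2) - 1) 0 x y := by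
  have hγ := isGamma_semidihedral hn
  refine ⟨_, _, isMetacyclicPair_nu hn hγ (even_quarter hn) odd_one ?_ ?_⟩
  · rw [nu_sq_of_odd hγ odd_one, pow_zero, hγ.nu_eq_one]
    ring
  · rw [nu_two_pow (by omega) hγ (four_mul_quarter (by omega)), nu_two_mul_nu (by omega),
      nu_mul_nu_of_odd hγ odd_one, Nat.cast_sub Nat.one_le_two_pow]
    push_cast
    congr 1
    linear_combination four_mul_quarter (n := n) (by omega)

theorem isMetacyclicPair_semidihedral' (hn : 3 ≤ n) :
    ∃ x y : gammaSubgroup (pairGamma (n := n) (2 ^ (n - 2)) (2 ^ (n - 1) - 2 - 2 ^ (n - 2))),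
      IsMetacyclicPair (2 ^ (n - 1)) (2 ^ (n - 2) - 1) 0 x y := by
  have hγ := isGamma_semidihedral' hn
  have h2 := two_mul_quarter (n := n) (by omega)
  have h4 := four_mul_quarter (n := n) (by omega)
  have h3 : Odd (3 : ZMod (2 ^ n)) := ⟨1, by norm_num⟩
  -- here `ν(1)` has order `4`, but `ν(3)` is an involution
  refine ⟨_, _, isMetacyclicPair_nu hn hγ (even_quarter hn) h3 ?_ ?_⟩
  · rw [nu_sq_of_odd hγ h3, pow_zero, hγ.nu_eq_one]
    linear_combination 3 * h4 - 3 * h2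
  · rw [nu_two_pow (by omega) hγ (four_mul_quarter (by omega)), nu_two_mul_nu (by omega),
      nu_mul_nu_of_odd hγ h3, Nat.cast_sub Nat.one_le_two_pow]
    push_cast
    congr 1
    linear_combination (2 - 2 ^ (n - 1)) * h4 + 2 * (1 - 2 ^ (n - 2)) * h2 +
      2 * two_mul_half (n := n) (by omega)
end

/-! ### Invariants separating the isomorphism types -/

/-- All squares are central. -/
def SquaresCentral (G : Type*) [Group G] : Prop := ∀ x y : G, Commute (x ^ 2) y

/-- All elements with trivial square are central. -/
def InvolutionsCentral (G : Type*) [Group G] : Prop := ∀ x y : G, x ^ 2 = 1 → Commute x y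

/-- Any two elements with nontrivial squares commute. -/
def NonInvolutionsCommute (G : Type*) [Group G] : Prop :=
  ∀ x y : G, x ^ 2 = 1 ∨ y ^ 2 = 1 ∨ Commute x y

section MulEquiv

variable {G H : Type*} [Group G] [Group H]

theorem MulEquiv.commute_iff (φ : G ≃* H) {x y : G} : Commute (φ x) (φ y) ↔ Commute x y := by
  rw [commute_iff_eq, commute_iff_eq, ← map_mul, ← map_mul, φ.apply_eq_iff_eq]

theorem SquaresCentral.of_mulEquiv (φ : G ≃* H) (h : SquaresCentral H) : SquaresCentral G :=
  fun x y => φ.commute_iff.mp (by simpa using h (φ x) (φ y))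

theorem InvolutionsCentral.of_mulEquiv (φ : G ≃* H) (h : InvolutionsCentral H) :
    InvolutionsCentral G :=
  fun x y hx => φ.commute_iff.mp (h (φ x) (φ y) (by rw [← map_pow, hx, map_one]))

theorem NonInvolutionsCommute.of_mulEquiv (φ : G ≃* H) (h : NonInvolutionsCommute H) :
    NonInvolutionsCommute G := fun x y => by
  have := h (φ x) (φ y)
  rwa [← map_pow, ← map_pow, φ.map_eq_one_iff, φ.map_eq_one_iff, φ.commute_iff] at this

theorem MulEquiv.forall_commute (φ : G ≃* H) (h : ∀ x y : H, Commute x y) (x y : G) :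
    Commute x y := φ.commute_iff.mp (h _ _)

end MulEquiv

section

variable {n : ℕ} {c t : ZMod (2 ^ n)}

theorem commute_nu_of_mul_eq_zero (hn : 1 ≤ n) (hγ : IsGamma (pairGamma c t)) {g : ZMod (2 ^ n)}
    (hg : Even g) (h0 : t * g = 0) (h : ZMod (2 ^ n)) : Commute (hγ.nu g) (hγ.nu h) := by
  rw [hγ.commute_nu, pairGamma_of_even hn hg]
  obtain hh | hh := even_or_odd h
  · rw [pairGamma_of_even hn hh]; ring
  · rw [pairGamma_of_odd hh]; linear_combination -h0

theorem commute_nu_of_even_of_odd (hn : 1 ≤ n) (hγ : IsGamma (pairGamma c t)) {g h : ZMod (2 ^ n)}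
    (hg : Even g) (hh : Odd h) : Commute (hγ.nu g) (hγ.nu h) ↔ t * g = 0 := by
  refine ⟨fun hc => ?_, fun h0 => commute_nu_of_mul_eq_zero hn hγ hg h0 h⟩
  rw [hγ.commute_nu, pairGamma_of_even hn hg, pairGamma_of_odd hh] at hc
  linear_combination -hc

theorem nu_sq_of_even (hn : 1 ≤ n) (hγ : IsGamma (pairGamma c t)) {g : ZMod (2 ^ n)}
    (hg : Even g) : hγ.nu g ^ 2 = hγ.nu (g * (2 + c * g)) := by
  rw [hγ.nu_sq, pairGamma_of_even hn hg]
  congr 1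
  ring

theorem not_forall_commute (hn : 1 ≤ n) (hγ : IsGamma (pairGamma c t)) (h : t * 2 ≠ 0) :
    ¬ ∀ x y : gammaSubgroup (pairGamma c t), Commute x y := fun hcomm =>
  h ((commute_nu_of_even_of_odd hn hγ even_two odd_one).mp (hcomm _ _))

theorem not_involutionsCentral (hn : 1 ≤ n) (hγ : IsGamma (pairGamma c t)) {g : ZMod (2 ^ n)}
    (hg : Odd g) (hsq : 2 + c * g + t = 0) (h : t * 2 ≠ 0) :
    ¬ InvolutionsCentral (gammaSubgroup (pairGamma c t)) := fun hcen =>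
  h ((commute_nu_of_even_of_odd hn hγ even_two hg).mp
    (hcen (hγ.nu g) (hγ.nu 2) (by rw [nu_sq_of_odd hγ hg, hsq, mul_zero, hγ.nu_zero])).symm)

theorem not_nonInvolutionsCommute (hn : 3 ≤ n) (hγ : IsGamma (pairGamma c t)) (hc : Even c)
    {g : ZMod (2 ^ n)} (hg : Odd g) (hsq : 2 + c * g + t ≠ 0) (h : t * 2 ≠ 0) :
    ¬ NonInvolutionsCommute (gammaSubgroup (pairGamma c t)) := fun hcom => by
  obtain h1 | h1 | h1 := hcom (hγ.nu 2) (hγ.nu g)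
  · rw [nu_sq_of_even (by omega) hγ even_two, hγ.nu_eq_one] at h1
    exact ZModTwoPow.four_ne_zero hn
      (odd_mul_eq_zero (odd_one.add_even hc) (by linear_combination h1))
  · rw [nu_sq_of_odd hγ hg, hγ.nu_eq_one] at h1
    exact hsq (odd_mul_eq_zero hg h1)
  · exact h ((commute_nu_of_even_of_odd (by omega) hγ even_two hg).mp h1)

theorem not_squaresCentral (hn : 1 ≤ n) (hγ : IsGamma (pairGamma c t)) (hc : Even c)
    (h : t * 4 ≠ 0) : ¬ SquaresCentral (gammaSubgroup (pairGamma c t)) := fun hcen => by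
  have h1 := hcen (hγ.nu 2) (hγ.nu 1)
  rw [nu_sq_of_even hn hγ even_two,
    commute_nu_of_even_of_odd hn hγ (even_two.mul_right _) odd_one] at h1
  exact h (odd_mul_eq_zero (odd_one.add_even hc) (by linear_combination h1))

theorem dihedral_noncomm (hn : 3 ≤ n) : (-2 : ZMod (2 ^ n)) * 2 ≠ 0 := fun h =>
  ZModTwoPow.four_ne_zero hn (by linear_combination -h)

theorem quaternion_noncomm (hn : 3 ≤ n) : ((2 : ZMod (2 ^ n)) ^ (n - 1) - 2) * 2 ≠ 0 := fun h =>
  ZModTwoPow.four_ne_zero hn (by linear_combination two_mul_half (n := n) (by omega) - h)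

theorem modular_noncomm (hn : 2 ≤ n) : (2 : ZMod (2 ^ n)) ^ (n - 2) * 2 ≠ 0 := fun h =>
  ZModTwoPow.half_ne_zero (n := n) (by omega) (by linear_combination h - two_mul_quarter hn)

theorem semidihedral_noncomm (hn : 4 ≤ n) :
    ((-2 : ZMod (2 ^ n)) - 2 ^ (n - 2)) * 4 ≠ 0 ∧
    ((2 : ZMod (2 ^ n)) ^ (n - 1) - 2 - 2 ^ (n - 2)) * 4 ≠ 0 := by
  have h4 := four_mul_quarter (n := n) (by omega)
  have h2 := two_mul_half (n := n) (by omega)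
  exact ⟨fun h => ZModTwoPow.eight_ne_zero hn (by linear_combination -h - h4),
    fun h => ZModTwoPow.eight_ne_zero hn (by linear_combination -h - h4 + 2 * h2)⟩

theorem nonInvolutionsCommute_dihedral (hn : 3 ≤ n) :
    NonInvolutionsCommute (gammaSubgroup (pairGamma (n := n) 0 (-2))) := fun x y => by
  have hγ := isGamma_dihedral hn
  obtain ⟨g, rfl⟩ := hγ.nu_surjective x
  obtain ⟨h, rfl⟩ := hγ.nu_surjective y
  have hodd {g : ZMod (2 ^ n)} (hg : Odd g) : hγ.nu g ^ 2 = 1 := by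
    rw [nu_sq_of_odd hγ hg, hγ.nu_eq_one]
    ring
  obtain hg | hg := even_or_odd g
  · obtain hh | hh := even_or_odd h
    · right; right
      rw [hγ.commute_nu, pairGamma_of_even (by omega) hg, pairGamma_of_even (by omega) hh]
      ring
    · exact Or.inr (Or.inl (hodd hh))
  · exact Or.inl (hodd hg)

theorem involutionsCentral_quaternion (hn : 3 ≤ n) :
    InvolutionsCentral (gammaSubgroup (pairGamma (n := n) 0 (2 ^ (n - 1) - 2))) :=
  fun x y hx => by
    have hγ := isGamma_quaternion hn
    obtain ⟨g, rfl⟩ := hγ.nu_surjective x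
    obtain ⟨h, rfl⟩ := hγ.nu_surjective y
    obtain hg | hg := even_or_odd g
    · rw [nu_sq_of_even (by omega) hγ hg, hγ.nu_eq_one] at hx
      refine commute_nu_of_mul_eq_zero (by omega) hγ hg ?_ h
      linear_combination half_mul_even (by omega) hg - hx
    · rw [nu_sq_of_odd hγ hg, hγ.nu_eq_one] at hx
      exact absurd (odd_mul_eq_zero hg (by linear_combination hx))
        (ZModTwoPow.half_ne_zero (by omega))

theorem squaresCentral_modular (hn : 4 ≤ n) (hc : 4 ∣ c - 2) :
    SquaresCentral (gammaSubgroup (pairGamma c (2 ^ (n - 2)))) := fun x y => by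
  have hγ := isGamma_modular hn hc
  obtain ⟨g, rfl⟩ := hγ.nu_surjective x
  obtain ⟨h, rfl⟩ := hγ.nu_surjective y
  have h4 := four_mul_quarter (n := n) (by omega)
  have hx : ∃ z, hγ.nu g ^ 2 = hγ.nu (4 * z) := by
    obtain hg | hg := even_or_odd g
    · rw [nu_sq_of_even (by omega) hγ hg]
      obtain ⟨k, rfl⟩ := hg.two_dvd
      exact ⟨k * (1 + c * k), congrArg _ (by ring)⟩
    · rw [nu_sq_of_odd hγ hg]
      obtain ⟨k, hk⟩ := hc
      obtain ⟨q, hq⟩ := four_dvd_quarter hn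
      obtain ⟨l, rfl⟩ := hg
      exact ⟨(2 * l + 1) * (1 + l + k * (2 * l + 1) + q),
        congrArg _ (by linear_combination (2 * l + 1) * hq + (2 * l + 1) ^ 2 * hk)⟩
  obtain ⟨z, hz⟩ := hx
  rw [hz]
  exact commute_nu_of_mul_eq_zero (by omega) hγ (even_of_four_dvd ⟨z, rfl⟩)
    (by linear_combination z * h4) h

theorem not_involutionsCentral_modular (hn : 4 ≤ n) (hc : 4 ∣ c - 2) :
    ¬ InvolutionsCentral (gammaSubgroup (pairGamma c (2 ^ (n - 2)))) ∧
    ¬ NonInvolutionsCommute (gammaSubgroup (pairGamma c (2 ^ (n - 2)))) := by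
  have hγ := isGamma_modular hn hc
  obtain ⟨d, hd, rfl⟩ := exists_odd_of_four_dvd_sub_two hc
  obtain ⟨q, hq⟩ := four_dvd_quarter hn
  obtain ⟨g, hg, hdg⟩ := exists_odd_mul_eq (y := -1 - 2 * q) (by omega) hd
    (odd_one.neg.sub_even (even_two_mul q))
  have h0 : 2 + 2 * d * g + 2 ^ (n - 2) = 0 := by linear_combination 2 * hdg + hq
  refine ⟨not_involutionsCentral (by omega) hγ hg h0 (modular_noncomm (by omega)),
    not_nonInvolutionsCommute (by omega) hγ (even_two_mul d) (hg.add_even even_two) ?_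
      (modular_noncomm (by omega))⟩
  exact fun h => ZModTwoPow.four_ne_zero (by omega)
    (odd_mul_eq_zero hd (by linear_combination h - h0))

end

/-! ### Counting the regular subgroups of each type -/

section

variable {n : ℕ} {N : Subgroup (Equiv.Perm (ZMod (2 ^ n)))}

/-- The properties that tell the types apart are invariant under isomorphism. -/
theorem invariants_iff {G H : Type*} [Group G] [Group H] (φ : G ≃* H) :
    ((∀ x y : G, Commute x y) ↔ ∀ x y : H, Commute x y) ∧ (IsCyclic G ↔ IsCyclic H) ∧
    (NonInvolutionsCommute G ↔ NonInvolutionsCommute H) ∧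
    (InvolutionsCentral G ↔ InvolutionsCentral H) ∧ (SquaresCentral G ↔ SquaresCentral H) :=
  ⟨⟨φ.symm.forall_commute, φ.forall_commute⟩, φ.isCyclic,
    ⟨.of_mulEquiv φ.symm, .of_mulEquiv φ⟩, ⟨.of_mulEquiv φ.symm, .of_mulEquiv φ⟩,
    ⟨.of_mulEquiv φ.symm, .of_mulEquiv φ⟩⟩

theorem forall_commute_of_isCyclic {G : Type*} [Group G] (h : IsCyclic G) (x y : G) :
    Commute x y :=
  letI := h.commGroup
  Commute.all x y

theorem cyclicFamily_subset (hn : 3 ≤ n) : cyclicFamily n ⊆ regularSubgroups (ZMod (2 ^ n)) := by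
  rintro _ ⟨c, hc, rfl⟩
  exact (isGamma_cyclic hn hc).gammaSubgroup_mem_regularSubgroups

theorem abelianFamily_subset (hn : 3 ≤ n) :
    abelianFamily n ⊆ regularSubgroups (ZMod (2 ^ n)) := by
  rintro _ ⟨c, hc, rfl⟩
  exact (isGamma_abelian hn hc).gammaSubgroup_mem_regularSubgroups

theorem modularFamily_subset (hn : 4 ≤ n) :
    modularFamily n ⊆ regularSubgroups (ZMod (2 ^ n)) := by
  rintro _ ⟨c, hc, rfl⟩
  exact (isGamma_modular hn hc).gammaSubgroup_mem_regularSubgroups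

theorem dihedralFamily_subset (hn : 3 ≤ n) :
    dihedralFamily n ⊆ regularSubgroups (ZMod (2 ^ n)) := by
  rintro _ rfl
  exact (isGamma_dihedral hn).gammaSubgroup_mem_regularSubgroups

theorem quaternionFamily_subset (hn : 3 ≤ n) :
    quaternionFamily n ⊆ regularSubgroups (ZMod (2 ^ n)) := by
  rintro _ rfl
  exact (isGamma_quaternion hn).gammaSubgroup_mem_regularSubgroups

theorem semidihedralFamily_subset (hn : 3 ≤ n) :
    semidihedralFamily n ⊆ regularSubgroups (ZMod (2 ^ n)) := by
  rintro _ (rfl | rfl)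
  · exact (isGamma_semidihedral hn).gammaSubgroup_mem_regularSubgroups
  · exact (isGamma_semidihedral' hn).gammaSubgroup_mem_regularSubgroups

theorem nonempty_mulEquiv_cyclic (hn : 3 ≤ n) (hN : N ∈ cyclicFamily n) :
    Nonempty (N ≃* Multiplicative (ZMod (2 ^ n))) := by
  have := isCyclic_of_mem_cyclicFamily hn hN
  obtain ⟨c, hc, rfl⟩ := hN
  refine ⟨mulEquivOfCyclicCardEq ?_⟩
  rw [(isGamma_cyclic hn hc).card_gammaSubgroup]
  simp

theorem nonempty_mulEquiv_abelian (hn : 3 ≤ n) (hN : N ∈ abelianFamily n) :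
    Nonempty (N ≃* (Multiplicative (ZMod 2) × Multiplicative (ZMod (2 ^ (n - 1))))) := by
  obtain ⟨c, hc, rfl⟩ := hN
  obtain ⟨x, y, h⟩ := isMetacyclicPair_abelian hn hc
  exact h.nonempty_mulEquiv (by positivity) (isMetacyclicPair_prod _)

theorem nonempty_mulEquiv_modular (hn : 4 ≤ n) (hN : N ∈ modularFamily n) :
    Nonempty (N ≃* ModularTwoGroup n) := by
  obtain ⟨c, hc, rfl⟩ := hN
  obtain ⟨x, y, h⟩ := isMetacyclicPair_modular hn hc
  exact h.nonempty_mulEquiv_presentedGroup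

theorem nonempty_mulEquiv_dihedral (hn : 3 ≤ n) (hN : N ∈ dihedralFamily n) :
    Nonempty (N ≃* DihedralGroup (2 ^ (n - 1))) := by
  obtain rfl := hN
  obtain ⟨x, y, h⟩ := isMetacyclicPair_dihedral hn
  exact h.nonempty_mulEquiv (by positivity) (isMetacyclicPair_dihedralGroup _)

theorem nonempty_mulEquiv_quaternion (hn : 3 ≤ n) (hN : N ∈ quaternionFamily n) :
    Nonempty (N ≃* QuaternionGroup (2 ^ (n - 2))) := by
  obtain rfl := hN
  obtain ⟨x, y, h⟩ := isMetacyclicPair_quaternion hn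
  rw [show 2 ^ (n - 1) = 2 * 2 ^ (n - 2) by rw [← pow_succ', show n - 2 + 1 = n - 1 by omega]] at h
  exact h.nonempty_mulEquiv (by positivity) (isMetacyclicPair_quaternionGroup _)

theorem nonempty_mulEquiv_semidihedral (hn : 3 ≤ n) (hN : N ∈ semidihedralFamily n) :
    Nonempty (N ≃* SemidihedralTwoGroup n) := by
  obtain rfl | rfl := hN
  · obtain ⟨x, y, h⟩ := isMetacyclicPair_semidihedral hn
    exact h.nonempty_mulEquiv_presentedGroup
  · obtain ⟨x, y, h⟩ := isMetacyclicPair_semidihedral' hn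
    exact h.nonempty_mulEquiv_presentedGroup

theorem invariants_cyclic (hn : 3 ≤ n) (hN : N ∈ cyclicFamily n) :
    (∀ x y : N, Commute x y) ∧ IsCyclic N :=
  ⟨forall_commute_of_isCyclic (isCyclic_of_mem_cyclicFamily hn hN),
    isCyclic_of_mem_cyclicFamily hn hN⟩

theorem invariants_abelian (hn : 3 ≤ n) (hN : N ∈ abelianFamily n) :
    (∀ x y : N, Commute x y) ∧ ¬ IsCyclic N := by
  obtain ⟨φ⟩ := nonempty_mulEquiv_abelian hn hN
  refine ⟨φ.forall_commute fun x y => Commute.all x y, fun h => ?_⟩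
  rw [φ.isCyclic, Group.isCyclic_prod_iff] at h
  have h2 := h.2.2
  simp only [Nat.card_eq_fintype_card, Fintype.card_multiplicative, ZMod.card] at h2
  rw [Nat.coprime_pow_right_iff (by omega)] at h2
  norm_num at h2

theorem not_isCyclic_of_not_forall_commute {G : Type*} [Group G]
    (h : ¬ ∀ x y : G, Commute x y) : ¬ IsCyclic G :=
  fun hc => h (forall_commute_of_isCyclic hc)

theorem invariants_dihedral (hn : 3 ≤ n) (hN : N ∈ dihedralFamily n) :
    (¬ ∀ x y : N, Commute x y) ∧ NonInvolutionsCommute N ∧ ¬ InvolutionsCentral N ∧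
      (4 ≤ n → ¬ SquaresCentral N) := by
  obtain rfl := hN
  have hγ := isGamma_dihedral hn
  have h2 := dihedral_noncomm hn
  exact ⟨not_forall_commute (by omega) hγ h2, nonInvolutionsCommute_dihedral hn,
    not_involutionsCentral (by omega) hγ odd_one (by ring) h2,
    fun hn4 => not_squaresCentral (by omega) hγ Even.zero fun h =>
      eight_ne_zero hn4 (by linear_combination -h)⟩

theorem invariants_quaternion (hn : 3 ≤ n) (hN : N ∈ quaternionFamily n) :
    (¬ ∀ x y : N, Commute x y) ∧ ¬ NonInvolutionsCommute N ∧ InvolutionsCentral N ∧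
      (4 ≤ n → ¬ SquaresCentral N) := by
  obtain rfl := hN
  have hγ := isGamma_quaternion hn
  have h2 := quaternion_noncomm hn
  exact ⟨not_forall_commute (by omega) hγ h2,
    not_nonInvolutionsCommute hn hγ Even.zero odd_one
      (fun h => half_ne_zero (n := n) (by omega) (by linear_combination h)) h2,
    involutionsCentral_quaternion hn,
    fun hn4 => not_squaresCentral (by omega) hγ Even.zero fun h =>
      eight_ne_zero hn4 (by linear_combination 2 * two_mul_half (n := n) (by omega) - h)⟩

theorem invariants_modular (hn : 4 ≤ n) (hN : N ∈ modularFamily n) :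
    (¬ ∀ x y : N, Commute x y) ∧ ¬ NonInvolutionsCommute N ∧ ¬ InvolutionsCentral N ∧
      SquaresCentral N := by
  obtain ⟨c, hc, rfl⟩ := hN
  have h := not_involutionsCentral_modular hn hc
  exact ⟨not_forall_commute (by omega) (isGamma_modular hn hc) (modular_noncomm (by omega)),
    h.2, h.1, squaresCentral_modular hn hc⟩

theorem invariants_semidihedral (hn : 4 ≤ n) (hN : N ∈ semidihedralFamily n) :
    (¬ ∀ x y : N, Commute x y) ∧ ¬ NonInvolutionsCommute N ∧ ¬ InvolutionsCentral N ∧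
      ¬ SquaresCentral N := by
  have hc := even_quarter (n := n) (by omega)
  have hq := two_mul_quarter (n := n) (by omega)
  have hh := two_mul_half (n := n) (by omega)
  have h3 : Odd (3 : ZMod (2 ^ n)) := ⟨1, by norm_num⟩
  have h2 {t : ZMod (2 ^ n)} (h4 : t * 4 ≠ 0) : t * 2 ≠ 0 :=
    fun h => h4 (by linear_combination 2 * h)
  obtain rfl | rfl := hN
  · have hγ := isGamma_semidihedral (n := n) (by omega)
    have h4 := (semidihedral_noncomm hn).1
    exact ⟨not_forall_commute (by omega) hγ (h2 h4),
      not_nonInvolutionsCommute (by omega) hγ hc h3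
        (fun h => half_ne_zero (n := n) (by omega) (by linear_combination h - hq)) (h2 h4),
      not_involutionsCentral (by omega) hγ odd_one (by ring) (h2 h4),
      not_squaresCentral (by omega) hγ hc h4⟩
  · have hγ := isGamma_semidihedral' (n := n) (by omega)
    have h4 := (semidihedral_noncomm hn).2
    exact ⟨not_forall_commute (by omega) hγ (h2 h4),
      not_nonInvolutionsCommute (by omega) hγ hc odd_one
        (fun h => half_ne_zero (n := n) (by omega) (by linear_combination h)) (h2 h4),
      not_involutionsCentral (by omega) hγ h3 (by linear_combination hq + hh) (h2 h4),
      not_squaresCentral (by omega) hγ hc h4⟩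

theorem four_dvd_two_sub_two : (4 : ZMod (2 ^ n)) ∣ 2 - 2 := ⟨0, by ring⟩

theorem regularSubgroupsOfType_cyclic (hn : 3 ≤ n) :
    regularSubgroupsOfType (ZMod (2 ^ n)) (Multiplicative (ZMod (2 ^ n))) = cyclicFamily n := by
  refine Set.Subset.antisymm (fun N hN => ?_)
    fun N hN => ⟨cyclicFamily_subset hn hN, nonempty_mulEquiv_cyclic hn hN⟩
  obtain ⟨hN, ⟨φ⟩⟩ := hN
  have hcyc : IsCyclic N := φ.isCyclic.mpr inferInstance
  obtain h | h | h | h | ⟨hn4, h | h⟩ := mem_family_of_mem_regularSubgroups hn hN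
  · exact h
  · exact absurd hcyc (invariants_abelian hn h).2
  · exact absurd hcyc (not_isCyclic_of_not_forall_commute (invariants_dihedral hn h).1)
  · exact absurd hcyc (not_isCyclic_of_not_forall_commute (invariants_quaternion hn h).1)
  · exact absurd hcyc (not_isCyclic_of_not_forall_commute (invariants_modular hn4 h).1)
  · exact absurd hcyc (not_isCyclic_of_not_forall_commute (invariants_semidihedral hn4 h).1)

theorem regularSubgroupsOfType_abelian (hn : 3 ≤ n) :
    regularSubgroupsOfType (ZMod (2 ^ n))
      (Multiplicative (ZMod 2) × Multiplicative (ZMod (2 ^ (n - 1)))) = abelianFamily n := by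
  refine Set.Subset.antisymm (fun N hN => ?_)
    fun N hN => ⟨abelianFamily_subset hn hN, nonempty_mulEquiv_abelian hn hN⟩
  obtain ⟨hN, ⟨φ⟩⟩ := hN
  have h0 : gammaSubgroup (pairGamma 2 0) ∈ abelianFamily n := ⟨2, four_dvd_two_sub_two, rfl⟩
  obtain ⟨φ₀⟩ := nonempty_mulEquiv_abelian hn h0
  obtain ⟨hcomm, hcyc, -, -, -⟩ := invariants_iff (φ.trans φ₀.symm)
  have hf := invariants_abelian hn h0
  obtain h | h | h | h | ⟨hn4, h | h⟩ := mem_family_of_mem_regularSubgroups hn hN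
  · exact (hf.2 (hcyc.mp (invariants_cyclic hn h).2)).elim
  · exact h
  · exact ((invariants_dihedral hn h).1 (hcomm.mpr hf.1)).elim
  · exact ((invariants_quaternion hn h).1 (hcomm.mpr hf.1)).elim
  · exact ((invariants_modular hn4 h).1 (hcomm.mpr hf.1)).elim
  · exact ((invariants_semidihedral hn4 h).1 (hcomm.mpr hf.1)).elim

theorem regularSubgroupsOfType_dihedral (hn : 3 ≤ n) :
    regularSubgroupsOfType (ZMod (2 ^ n)) (DihedralGroup (2 ^ (n - 1))) = dihedralFamily n := by
  refine Set.Subset.antisymm (fun N hN => ?_)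
    fun N hN => ⟨dihedralFamily_subset hn hN, nonempty_mulEquiv_dihedral hn hN⟩
  obtain ⟨hN, ⟨φ⟩⟩ := hN
  have h0 : gammaSubgroup (pairGamma 0 (-2)) ∈ dihedralFamily n := rfl
  obtain ⟨φ₀⟩ := nonempty_mulEquiv_dihedral hn h0
  obtain ⟨hcomm, -, hnic, -, -⟩ := invariants_iff (φ.trans φ₀.symm)
  have hf := invariants_dihedral hn h0
  obtain h | h | h | h | ⟨hn4, h | h⟩ := mem_family_of_mem_regularSubgroups hn hN
  · exact (hf.1 (hcomm.mp (invariants_cyclic hn h).1)).elim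
  · exact (hf.1 (hcomm.mp (invariants_abelian hn h).1)).elim
  · exact h
  · exact ((invariants_quaternion hn h).2.1 (hnic.mpr hf.2.1)).elim
  · exact ((invariants_modular hn4 h).2.1 (hnic.mpr hf.2.1)).elim
  · exact ((invariants_semidihedral hn4 h).2.1 (hnic.mpr hf.2.1)).elim

theorem regularSubgroupsOfType_quaternion (hn : 3 ≤ n) :
    regularSubgroupsOfType (ZMod (2 ^ n)) (QuaternionGroup (2 ^ (n - 2))) =
      quaternionFamily n := by
  refine Set.Subset.antisymm (fun N hN => ?_)
    fun N hN => ⟨quaternionFamily_subset hn hN, nonempty_mulEquiv_quaternion hn hN⟩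
  obtain ⟨hN, ⟨φ⟩⟩ := hN
  have h0 : gammaSubgroup (pairGamma 0 (2 ^ (n - 1) - 2)) ∈ quaternionFamily n := rfl
  obtain ⟨φ₀⟩ := nonempty_mulEquiv_quaternion hn h0
  obtain ⟨hcomm, -, -, hic, -⟩ := invariants_iff (φ.trans φ₀.symm)
  have hf := invariants_quaternion hn h0
  obtain h | h | h | h | ⟨hn4, h | h⟩ := mem_family_of_mem_regularSubgroups hn hN
  · exact (hf.1 (hcomm.mp (invariants_cyclic hn h).1)).elim
  · exact (hf.1 (hcomm.mp (invariants_abelian hn h).1)).elim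
  · exact ((invariants_dihedral hn h).2.2.1 (hic.mpr hf.2.2.1)).elim
  · exact h
  · exact ((invariants_modular hn4 h).2.2.1 (hic.mpr hf.2.2.1)).elim
  · exact ((invariants_semidihedral hn4 h).2.2.1 (hic.mpr hf.2.2.1)).elim

theorem regularSubgroupsOfType_modular (hn : 4 ≤ n) :
    regularSubgroupsOfType (ZMod (2 ^ n)) (ModularTwoGroup n) = modularFamily n := by
  refine Set.Subset.antisymm (fun N hN => ?_)
    fun N hN => ⟨modularFamily_subset hn hN, nonempty_mulEquiv_modular hn hN⟩
  obtain ⟨hN, ⟨φ⟩⟩ := hN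
  have h0 : gammaSubgroup (pairGamma 2 (2 ^ (n - 2))) ∈ modularFamily n :=
    ⟨2, four_dvd_two_sub_two, rfl⟩
  obtain ⟨φ₀⟩ := nonempty_mulEquiv_modular hn h0
  obtain ⟨hcomm, -, -, -, hsc⟩ := invariants_iff (φ.trans φ₀.symm)
  have hf := invariants_modular hn h0
  have hn3 : 3 ≤ n := by omega
  obtain h | h | h | h | ⟨-, h | h⟩ := mem_family_of_mem_regularSubgroups hn3 hN
  · exact (hf.1 (hcomm.mp (invariants_cyclic hn3 h).1)).elim
  · exact (hf.1 (hcomm.mp (invariants_abelian hn3 h).1)).elim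
  · exact ((invariants_dihedral hn3 h).2.2.2 hn (hsc.mpr hf.2.2.2)).elim
  · exact ((invariants_quaternion hn3 h).2.2.2 hn (hsc.mpr hf.2.2.2)).elim
  · exact h
  · exact ((invariants_semidihedral hn h).2.2.2 (hsc.mpr hf.2.2.2)).elim

theorem regularSubgroupsOfType_semidihedral (hn : 4 ≤ n) :
    regularSubgroupsOfType (ZMod (2 ^ n)) (SemidihedralTwoGroup n) = semidihedralFamily n := by
  have hn3 : 3 ≤ n := by omega
  refine Set.Subset.antisymm (fun N hN => ?_)
    fun N hN => ⟨semidihedralFamily_subset hn3 hN, nonempty_mulEquiv_semidihedral hn3 hN⟩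
  obtain ⟨hN, ⟨φ⟩⟩ := hN
  have h0 : gammaSubgroup (pairGamma (2 ^ (n - 2)) (-2 - 2 ^ (n - 2))) ∈ semidihedralFamily n :=
    Or.inl rfl
  obtain ⟨φ₀⟩ := nonempty_mulEquiv_semidihedral hn3 h0
  obtain ⟨hcomm, -, hnic, hic, hsc⟩ := invariants_iff (φ.trans φ₀.symm)
  have hf := invariants_semidihedral hn h0
  obtain h | h | h | h | ⟨-, h | h⟩ := mem_family_of_mem_regularSubgroups hn3 hN
  · exact (hf.1 (hcomm.mp (invariants_cyclic hn3 h).1)).elim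
  · exact (hf.1 (hcomm.mp (invariants_abelian hn3 h).1)).elim
  · exact (hf.2.1 (hnic.mp (invariants_dihedral hn3 h).2.1)).elim
  · exact (hf.2.2.1 (hic.mp (invariants_quaternion hn3 h).2.2.1)).elim
  · exact (hf.2.2.2 (hsc.mp (invariants_modular hn h).2.2.2)).elim
  · exact h

theorem ncard_cyclicFamily (hn : 3 ≤ n) : (cyclicFamily n).ncard = 2 ^ (n - 2) := by
  rw [cyclicFamily, Set.InjOn.ncard_image, ncard_four_dvd (by omega)]
  intro c hc c' hc' h
  have h1 := congrFun ((isGamma_cyclic hn hc).gammaSubgroup_injective (isGamma_cyclic hn hc') h) 1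
  rw [pairGamma_one, pairGamma_one] at h1
  linear_combination h1

theorem ncard_abelianFamily (hn : 3 ≤ n) : (abelianFamily n).ncard = 2 ^ (n - 2) := by
  rw [abelianFamily, Set.InjOn.ncard_image, ncard_four_dvd_sub_two (by omega)]
  intro c hc c' hc' h
  have h1 := congrFun ((isGamma_abelian hn hc).gammaSubgroup_injective (isGamma_abelian hn hc') h) 1
  rw [pairGamma_one, pairGamma_one] at h1
  linear_combination h1

theorem ncard_modularFamily (hn : 4 ≤ n) : (modularFamily n).ncard = 2 ^ (n - 2) := by
  rw [modularFamily, Set.InjOn.ncard_image, ncard_four_dvd_sub_two (by omega)]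
  intro c hc c' hc' h
  have h1 := congrFun ((isGamma_modular hn hc).gammaSubgroup_injective (isGamma_modular hn hc') h) 1
  rw [pairGamma_one, pairGamma_one] at h1
  linear_combination h1

theorem ncard_semidihedralFamily (hn : 3 ≤ n) : (semidihedralFamily n).ncard = 2 := by
  refine Set.ncard_pair fun h => ?_
  have h1 := congrFun ((isGamma_semidihedral hn).gammaSubgroup_injective
    (isGamma_semidihedral' hn) h) 1
  rw [pairGamma_one, pairGamma_one] at h1
  exact half_ne_zero (n := n) (by omega) (by linear_combination -h1)

/-- For `n = 3` the group with the semidihedral presentation is `C₂ × C₄`. -/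
theorem ncard_regularSubgroupsOfType_semidihedral (hn : 3 ≤ n) :
    (regularSubgroupsOfType (ZMod (2 ^ n)) (SemidihedralTwoGroup n)).ncard = 2 := by
  obtain rfl | hn4 := hn.eq_or_lt
  · obtain ⟨φ⟩ := (isMetacyclicPair_prod (2 ^ (3 - 1))).nonempty_mulEquiv_presentedGroup
    have : regularSubgroupsOfType (ZMod (2 ^ 3)) (SemidihedralTwoGroup 3) =
        regularSubgroupsOfType (ZMod (2 ^ 3))
          (Multiplicative (ZMod 2) × Multiplicative (ZMod (2 ^ (3 - 1)))) := by
      ext N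
      exact and_congr_right fun _ =>
        ⟨fun ⟨ψ⟩ => ⟨ψ.trans φ.symm⟩, fun ⟨ψ⟩ => ⟨ψ.trans φ⟩⟩
    rw [this, regularSubgroupsOfType_abelian le_rfl, ncard_abelianFamily le_rfl]
    norm_num
  · rw [regularSubgroupsOfType_semidihedral hn4, ncard_semidihedralFamily hn]

theorem ncard_regularSubgroups (hn : 4 ≤ n) :
    (regularSubgroups (ZMod (2 ^ n))).ncard = 3 * 2 ^ (n - 2) + 4 := by
  have hn3 : 3 ≤ n := by omega
  have hunion : regularSubgroups (ZMod (2 ^ n)) = cyclicFamily n ∪ (abelianFamily n ∪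
      (dihedralFamily n ∪ (quaternionFamily n ∪ (modularFamily n ∪ semidihedralFamily n)))) := by
    refine Set.Subset.antisymm (fun N hN => ?_) ?_
    · have := mem_family_of_mem_regularSubgroups hn3 hN
      simp only [Set.mem_union]
      tauto
    · simp only [Set.union_subset_iff]
      exact ⟨cyclicFamily_subset hn3, abelianFamily_subset hn3, dihedralFamily_subset hn3,
        quaternionFamily_subset hn3, modularFamily_subset hn, semidihedralFamily_subset hn3⟩
  have hd1 : Disjoint (modularFamily n) (semidihedralFamily n) := by
    rw [Set.disjoint_left]
    exact fun N h1 h => (invariants_semidihedral hn h).2.2.2 (invariants_modular hn h1).2.2.2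
  have hd2 : Disjoint (quaternionFamily n)
      (modularFamily n ∪ semidihedralFamily n) := by
    rw [Set.disjoint_left]
    rintro N h1 (h | h)
    · exact (invariants_modular hn h).2.2.1 (invariants_quaternion hn3 h1).2.2.1
    · exact (invariants_semidihedral hn h).2.2.1 (invariants_quaternion hn3 h1).2.2.1
  have hd3 : Disjoint (dihedralFamily n)
      (quaternionFamily n ∪ (modularFamily n ∪ semidihedralFamily n)) := by
    rw [Set.disjoint_left]
    rintro N h1 (h | h | h)
    · exact (invariants_quaternion hn3 h).2.1 (invariants_dihedral hn3 h1).2.1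
    · exact (invariants_modular hn h).2.1 (invariants_dihedral hn3 h1).2.1
    · exact (invariants_semidihedral hn h).2.1 (invariants_dihedral hn3 h1).2.1
  have hd4 : Disjoint (abelianFamily n)
      (dihedralFamily n ∪ (quaternionFamily n ∪ (modularFamily n ∪ semidihedralFamily n))) := by
    rw [Set.disjoint_left]
    rintro N h1 (h | h | h | h)
    · exact (invariants_dihedral hn3 h).1 (invariants_abelian hn3 h1).1
    · exact (invariants_quaternion hn3 h).1 (invariants_abelian hn3 h1).1
    · exact (invariants_modular hn h).1 (invariants_abelian hn3 h1).1
    · exact (invariants_semidihedral hn h).1 (invariants_abelian hn3 h1).1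
  have hd5 : Disjoint (cyclicFamily n)
      (abelianFamily n ∪ (dihedralFamily n ∪ (quaternionFamily n ∪
        (modularFamily n ∪ semidihedralFamily n)))) := by
    rw [Set.disjoint_left]
    rintro N h1 (h | h | h | h | h)
    · exact (invariants_abelian hn3 h).2 (invariants_cyclic hn3 h1).2
    · exact (invariants_dihedral hn3 h).1 (invariants_cyclic hn3 h1).1
    · exact (invariants_quaternion hn3 h).1 (invariants_cyclic hn3 h1).1
    · exact (invariants_modular hn h).1 (invariants_cyclic hn3 h1).1
    · exact (invariants_semidihedral hn h).1 (invariants_cyclic hn3 h1).1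
  rw [hunion, Set.ncard_union_eq hd5, Set.ncard_union_eq hd4, Set.ncard_union_eq hd3,
    Set.ncard_union_eq hd2, Set.ncard_union_eq hd1, ncard_cyclicFamily hn3,
    ncard_abelianFamily hn3, ncard_modularFamily hn, ncard_semidihedralFamily hn3,
    dihedralFamily, quaternionFamily, Set.ncard_singleton, Set.ncard_singleton]
  ring

end

/-! ### Regular subgroups that are normal in the holomorph -/

section

variable {n : ℕ}

/-- If `u ^ 2 = 1`, then `pairGamma 0 (u - 1)` is the gamma function `g ↦ u ^ g`. -/
theorem isGamma_parity (hn : 1 ≤ n) {u : ZMod (2 ^ n)} (hu : u * u = 1) :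
    IsGamma (pairGamma 0 (u - 1)) :=
  isGamma_pairGamma hn Even.zero
    ((odd_of_isUnit hn (IsUnit.of_mul_eq_one _ hu)).sub_odd odd_one) (by ring)
    (by linear_combination hu)

/-- Conjugation by `x ↦ k * x` shows that `γ` is constant on odd elements, and then the relation
`γ (1 + γ 1 * h) = γ 1 * γ h` gives its values at even elements. -/
theorem exists_eq_parity_of_normal (hn : 1 ≤ n) {γ : ZMod (2 ^ n) → ZMod (2 ^ n)}
    (hγ : IsGamma γ)
    (hnormal : ((gammaSubgroup γ).subgroupOf (Holomorph (ZMod (2 ^ n)))).Normal) :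
    ∃ u, u * u = 1 ∧ γ = pairGamma 0 (u - 1) := by
  have hodd (k : ZMod (2 ^ n)) (hk : Odd k) : γ k = γ 1 := by
    obtain ⟨u, rfl⟩ := isUnit_of_odd hk
    let p : Equiv.Perm (ZMod (2 ^ n)) := u.mulLeft
    have hp : p ∈ Holomorph (ZMod (2 ^ n)) :=
      mem_holomorph_iff.mpr ⟨u, 0, fun x => by simp [p]⟩
    have hle := hγ.gammaSubgroup_mem_regularSubgroups.1
    have hmem := hnormal.conj_mem ⟨hγ.perm 1, hle (hγ.perm_mem 1)⟩ (hγ.perm_mem 1) ⟨p, hp⟩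
    obtain ⟨g, hg⟩ := hγ.mem_gammaSubgroup.mp (show p * hγ.perm 1 * p⁻¹ ∈ gammaSubgroup γ from hmem)
    rw [eq_mul_inv_iff_mul_eq] at hg
    have h0 := congrArg (fun q => q 0) hg
    have h1 := congrArg (fun q => q 1) hg
    simp only [Equiv.Perm.mul_apply, hγ.perm_apply, p, Units.mulLeft_apply, mul_zero, zero_add,
      mul_one] at h0 h1
    rw [h0] at h1
    exact u.isUnit.mul_left_cancel (by linear_combination h1)
  have heven (h : ZMod (2 ^ n)) (hh : Even h) : γ h = 1 := by
    have hm := hγ.map_mul 1 h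
    rw [hodd _ (odd_one.add_even (hh.mul_left _))] at hm
    exact (hγ.isUnit 1).mul_left_cancel (by linear_combination -hm)
  refine ⟨γ 1, ?_, funext fun b => ?_⟩
  · rw [← hγ.map_mul]
    exact heven _ (odd_one.add_odd ((hγ.odd hn 1).mul odd_one))
  · obtain hb | hb := even_or_odd b
    · rw [heven b hb, pairGamma_of_even hn hb]; ring
    · rw [hodd b hb, pairGamma_of_odd hb]; ring

theorem normal_parity (hn : 1 ≤ n) {u : ZMod (2 ^ n)} (hu : u * u = 1) :
    ((gammaSubgroup (pairGamma 0 (u - 1))).subgroupOf (Holomorph (ZMod (2 ^ n)))).Normal := by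
  have hγ := isGamma_parity hn hu
  refine ⟨fun q hq p => ?_⟩
  obtain ⟨p, hp⟩ := p
  obtain ⟨q, hqH⟩ := q
  obtain ⟨a, b, hab⟩ := mem_holomorph_iff.mp hp
  have ha : Odd a := odd_of_isUnit hn (isUnit_of_perm_apply hab)
  obtain ⟨g, rfl⟩ := hγ.mem_gammaSubgroup.mp (Subgroup.mem_subgroupOf.mp hq)
  refine Subgroup.mem_subgroupOf.mpr (hγ.mem_gammaSubgroup.mpr
    ⟨a * g + (1 - pairGamma 0 (u - 1) g) * b, ?_⟩)
  have hev : Even ((1 - pairGamma 0 (u - 1) g) * b) :=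
    (odd_one.sub_odd (hγ.odd hn g)).mul_right b
  have hsame : pairGamma 0 (u - 1) (a * g + (1 - pairGamma 0 (u - 1) g) * b) =
      pairGamma 0 (u - 1) g := by
    obtain hg | hg := even_or_odd g
    · rw [pairGamma_of_even hn ((hg.mul_left a).add hev), pairGamma_of_even hn hg]
      ring
    · rw [pairGamma_of_odd ((ha.mul hg).add_even hev), pairGamma_of_odd hg]
      ring
  change _ = p * hγ.perm g * p⁻¹
  rw [eq_mul_inv_iff_mul_eq]
  ext1 x
  rw [Equiv.Perm.mul_apply, Equiv.Perm.mul_apply, hγ.perm_apply, hγ.perm_apply, hsame, hab, hab]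
  ring

theorem mul_self_of_mem_roots (hn : 3 ≤ n) {u : ZMod (2 ^ n)}
    (hu : u ∈ ({1, 2 ^ (n - 1) + 1, 2 ^ (n - 1) - 1, -1} : Set (ZMod (2 ^ n)))) : u * u = 1 := by
  have h1 := two_mul_half (n := n) (by omega)
  have h2 := half_mul_even (by omega) (even_half hn)
  obtain rfl | rfl | rfl | rfl := hu
  · ring
  · linear_combination h1 + h2
  · linear_combination h2 - h1
  · ring

theorem regularNormalSubgroups_eq (hn : 3 ≤ n) :
    regularNormalSubgroups (ZMod (2 ^ n)) =
      (fun u => gammaSubgroup (pairGamma 0 (u - 1))) ''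
        {1, 2 ^ (n - 1) + 1, 2 ^ (n - 1) - 1, -1} := by
  ext N
  constructor
  · rintro ⟨hN, hnormal⟩
    obtain ⟨γ, hγ, rfl⟩ := exists_gammaSubgroup_eq hN
    obtain ⟨u, hu, rfl⟩ := exists_eq_parity_of_normal (by omega) hγ hnormal
    exact ⟨u, ZModTwoPow.mul_self_eq_one hn hu, rfl⟩
  · rintro ⟨u, hu, rfl⟩
    have hu2 := mul_self_of_mem_roots hn hu
    exact ⟨(isGamma_parity (by omega) hu2).gammaSubgroup_mem_regularSubgroups,
      normal_parity (by omega) hu2⟩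

theorem ncard_regularNormalSubgroups (hn : 3 ≤ n) :
    (regularNormalSubgroups (ZMod (2 ^ n))).ncard = 4 := by
  have h0 := half_ne_zero (n := n) (by omega)
  have h1 := two_mul_half (n := n) (by omega)
  have h4 := ZModTwoPow.four_ne_zero hn
  have h2 : (2 : ZMod (2 ^ n)) ≠ 0 := fun h => h4 (by linear_combination 2 * h)
  rw [regularNormalSubgroups_eq hn, Set.InjOn.ncard_image, Set.ncard_insert_of_notMem,
    Set.ncard_insert_of_notMem, Set.ncard_pair]
  · exact fun h => h0 (by linear_combination h)
  · rintro (h | h)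
    · exact h2 (by linear_combination h)
    · exact h4 (by linear_combination 2 * (Set.mem_singleton_iff.mp h) - h1)
  · rintro (h | h | h)
    · exact h0 (by linear_combination -h)
    · exact h4 (by linear_combination 2 * h + h1)
    · exact h2 (by linear_combination Set.mem_singleton_iff.mp h)
  · intro u hu v hv huv
    have := congrFun ((isGamma_parity (by omega)
      (mul_self_of_mem_roots hn hu)).gammaSubgroup_injective
      (isGamma_parity (by omega) (mul_self_of_mem_roots hn hv)) huv) 1
    rw [pairGamma_one, pairGamma_one] at this
    linear_combination this

theorem nsmul_sigmaAut_apply (k : ℕ) (hk : Odd k) (m : ℕ) (x : ZMod (2 ^ n)) :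
    (m • sigmaAut n k hk) x = (k : ZMod (2 ^ n)) ^ m * x := by
  induction m generalizing x with
  | zero => simp
  | succ m ih =>
    rw [succ_nsmul, AddAut.add_apply, ih, pow_succ, mul_assoc]
    rfl

theorem gammaPerms_powGamma_eq (hn : 1 ≤ n) {k : ℕ} (hk : Odd k)
    (hk2 : (k : ZMod (2 ^ n)) * k = 1) :
    (gammaSubgroup (pairGamma 0 ((k : ZMod (2 ^ n)) - 1)) : Set (Equiv.Perm (ZMod (2 ^ n)))) =
      gammaPerms n (powGamma n (sigmaAut n k hk)) := by
  have hγ := isGamma_parity hn hk2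
  have hperm (g : ZMod (2 ^ n)) : hγ.perm g =
      (AddEquiv.toEquiv (powGamma n (sigmaAut n k hk) g)).trans (Equiv.addRight g) := by
    ext1 x
    change _ = (g.val • sigmaAut n k hk) x + g
    rw [nsmul_sigmaAut_apply, hγ.perm_apply]
    congr 2
    obtain ⟨m, hm⟩ | ⟨m, hm⟩ := Nat.even_or_odd g.val
    · have hg : Even g := by
        rw [← ZMod.natCast_zmod_val g, hm]; exact ⟨m, by push_cast; rfl⟩
      rw [pairGamma_of_even hn hg, hm, ← two_mul, pow_mul, sq, hk2, one_pow]
      ring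
    · have hg : Odd g := by
        rw [← ZMod.natCast_zmod_val g, hm]; exact ⟨m, by push_cast; rfl⟩
      rw [pairGamma_of_odd hg, hm, pow_succ, pow_mul, sq, hk2, one_pow]
      ring
  ext p
  simp only [gammaPerms, Set.mem_range, SetLike.mem_coe, hγ.mem_gammaSubgroup, hperm]

end

/-! ### The classification -/

theorem mainTheorem4 (n : ℕ) (hn : 3 ≤ n) :
    -- the regular normal subgroups are exactly the four groups `N₁, N₂, N₃, N₄`
    (∃ N₁ N₂ N₃ N₄ : Subgroup (Equiv.Perm (ZMod (2 ^ n))),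
      (N₁ : Set (Equiv.Perm (ZMod (2 ^ n)))) =
        gammaPerms n (powGamma n (sigmaAut n 1 odd_one)) ∧
      (N₂ : Set (Equiv.Perm (ZMod (2 ^ n)))) =
        gammaPerms n (powGamma n (sigmaAut n (2 ^ (n - 1) + 1) (odd_half_add_one hn))) ∧
      (N₃ : Set (Equiv.Perm (ZMod (2 ^ n)))) =
        gammaPerms n (powGamma n (sigmaAut n (2 ^ (n - 1) - 1) (odd_half_sub_one hn))) ∧
      (N₄ : Set (Equiv.Perm (ZMod (2 ^ n)))) =
        gammaPerms n (powGamma n (sigmaAut n (2 ^ n - 1) (odd_full_sub_one hn))) ∧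
      regularNormalSubgroups (ZMod (2 ^ n)) = {N₁, N₂, N₃, N₄}) ∧
    (regularNormalSubgroups (ZMod (2 ^ n))).ncard = 4 ∧
    -- the number of regular subgroups of each isomorphism type
    (regularSubgroupsOfType (ZMod (2 ^ n)) (Multiplicative (ZMod (2 ^ n)))).ncard
      = 2 ^ (n - 2) ∧
    (regularSubgroupsOfType (ZMod (2 ^ n)) (QuaternionGroup (2 ^ (n - 2)))).ncard = 1 ∧
    (regularSubgroupsOfType (ZMod (2 ^ n)) (DihedralGroup (2 ^ (n - 1)))).ncard = 1 ∧
    (regularSubgroupsOfType (ZMod (2 ^ n)) (SemidihedralTwoGroup n)).ncard = 2 ∧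
    (regularSubgroupsOfType (ZMod (2 ^ n))
      (Multiplicative (ZMod 2) × Multiplicative (ZMod (2 ^ (n - 1))))).ncard = 2 ^ (n - 2) ∧
    (4 ≤ n → (regularSubgroupsOfType (ZMod (2 ^ n)) (ModularTwoGroup n)).ncard = 2 ^ (n - 2)) ∧
    -- these types exhaust the regular subgroups
    (∀ N ∈ regularSubgroups (ZMod (2 ^ n)),
      Nonempty (N ≃* Multiplicative (ZMod (2 ^ n))) ∨
      Nonempty (N ≃* QuaternionGroup (2 ^ (n - 2))) ∨
      Nonempty (N ≃* DihedralGroup (2 ^ (n - 1))) ∨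
      Nonempty (N ≃* SemidihedralTwoGroup n) ∨
      Nonempty (N ≃* (Multiplicative (ZMod 2) × Multiplicative (ZMod (2 ^ (n - 1))))) ∨
      Nonempty (N ≃* ModularTwoGroup n)) ∧
    -- the total number of regular subgroups
    (4 ≤ n → (regularSubgroups (ZMod (2 ^ n))).ncard = 3 * 2 ^ (n - 2) + 4) := by
  refine ⟨?_, ncard_regularNormalSubgroups hn, ?_, ?_, ?_,
    ncard_regularSubgroupsOfType_semidihedral hn, ?_, ?_, ?_, ncard_regularSubgroups⟩
  · have hcast1 : ((1 : ℕ) : ZMod (2 ^ n)) = 1 := Nat.cast_one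
    have hcast2 : ((2 ^ (n - 1) + 1 : ℕ) : ZMod (2 ^ n)) = 2 ^ (n - 1) + 1 := by push_cast; rfl
    have hcast3 : ((2 ^ (n - 1) - 1 : ℕ) : ZMod (2 ^ n)) = 2 ^ (n - 1) - 1 := by
      rw [Nat.cast_sub Nat.one_le_two_pow]; push_cast; rfl
    have hcast4 : ((2 ^ n - 1 : ℕ) : ZMod (2 ^ n)) = -1 := by
      rw [Nat.cast_sub Nat.one_le_two_pow]; push_cast; rw [two_pow_self]; ring
    refine ⟨_, _, _, _,
      gammaPerms_powGamma_eq (by omega) _ (mul_self_of_mem_roots hn (by simp [hcast1])),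
      gammaPerms_powGamma_eq (by omega) _ (mul_self_of_mem_roots hn (by simp [hcast2])),
      gammaPerms_powGamma_eq (by omega) _ (mul_self_of_mem_roots hn (by simp [hcast3])),
      gammaPerms_powGamma_eq (by omega) _ (mul_self_of_mem_roots hn (by simp [hcast4])), ?_⟩
    rw [regularNormalSubgroups_eq hn, hcast1, hcast2, hcast3, hcast4]
    simp only [Set.image_insert_eq, Set.image_singleton]
  · rw [regularSubgroupsOfType_cyclic hn, ncard_cyclicFamily hn]
  · rw [regularSubgroupsOfType_quaternion hn, quaternionFamily, Set.ncard_singleton]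
  · rw [regularSubgroupsOfType_dihedral hn, dihedralFamily, Set.ncard_singleton]
  · rw [regularSubgroupsOfType_abelian hn, ncard_abelianFamily hn]
  · intro hn4
    rw [regularSubgroupsOfType_modular hn4, ncard_modularFamily hn4]
  · intro N hN
    obtain h | h | h | h | ⟨hn4, h | h⟩ := mem_family_of_mem_regularSubgroups hn hN
    · exact Or.inl (nonempty_mulEquiv_cyclic hn h)
    · exact Or.inr (Or.inr (Or.inr (Or.inr (Or.inl (nonempty_mulEquiv_abelian hn h)))))
    · exact Or.inr (Or.inr (Or.inl (nonempty_mulEquiv_dihedral hn h)))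
    · exact Or.inr (Or.inl (nonempty_mulEquiv_quaternion hn h))
    · exact Or.inr (Or.inr (Or.inr (Or.inr (Or.inr (nonempty_mulEquiv_modular hn4 h)))))
    · exact Or.inr (Or.inr (Or.inr (Or.inl (nonempty_mulEquiv_semidihedral hn h))))
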